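/- Let $a,b>0$, $\alpha\in(0,3)$, $p>4$ be real, and regard $\mathbb Z^3$ as the lattice graph in which $x\sim y$ iff $\sum_i|x_i-y_i|=1$, with graph distance $|x-y|$ and counting measure $\mu$. For $u,v:\mathbb Z^3\to\mathbb R$ put $$\Delta u(x)=\sum_{y\sim x}(u(y)-u(x)),\qquad (\nabla u\nabla v)(x)=\tfrac12\sum_{y\sim x}(u(y)-u(x))(v(y)-v(x)),\qquad |\nabla u|^2=\nabla u\nabla u .$$ Let $R_\alpha$ be the Green's function of the discrete fractional Laplacian, $$R_\alpha(x,y)=\frac{K_\alpha}{(2\pi)^3}\int_{[0,2\pi]^3}e^{i(x-y)\cdot k}\,\omega(k)^{-\alpha/2}\,dk,\quad K_\alpha=\frac1{(2\pi)^3}\int_{[0,2\pi]^3}\omega(k)^{\alpha/2}\,dk,\quad \omega(k)=6-2\sum_{j=1}^3\cos k_j,$$ and $(R_\alpha*f)(x)=\sum_{y}R_\alpha(x,y)f(y)$. Let $h:\mathbb Z^3\to\mathbb R$ satisfy - $(h_1)$ there is $h_0>0$ with $h(x)\ge h_0$ for all $x$; - $(h_3)$ there is $x_0\in\mathbb Z^3$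 with $h(x)\to\infty$ as $|x-x_0|\to\infty$. Let $H^1(\mathbb Z^3)$ be the completion of the finitely supported functions in the norm $\big(\int(|\nabla u|^2+u^2)\,d\mu\big)^{1/2}$ (a space of functions on $\mathbb Z^3$), and let $H=\{u\in H^1(\mathbb Z^3):\int h u^2\,d\mu<\infty\}$ carry the inner product $\langle u,v\rangle=\int(a\nabla u\nabla v+huv)\,d\mu$. On $H$ define $$J(u)=\frac12\int(a|\nabla u|^2+hu^2)\,d\mu+\frac b4\Big(\int|\nabla u|^2\,d\mu\Big)^2-\frac1{2p}\int(R_\alpha*|u|^p)|u|^p\,d\mu .$$ With $u^+=\max\{u,0\}$, $u^-=\min\{u,0\}$ and $J'$ the Fréchet derivative of $J$ on $H$, let $$\mathcal M=\{u\in H:\ u^\pm\ne0,\ (J'(u),u^+)=(J'(u),u^-)=0\},\qquad m=\inf_{\mathcal M}J .$$ **Theorem.** The functional $J$ is Fréchet differentiable on $H$, and the Kirchhoff–Choquard equation $$-\Big(a+b\int_{\mathbb Z^3}|\nabla u|^2\,d\mu\Big)\Delta u+h(x)u=(R_\alpha*|u|^p)|u|^{p-2}u,\qquad x\in\mathbb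 Z^3,$$ has a ground state sign-changing solution: there is $u\in\mathcal M$ (so $u^+\neq0$ and $u^-\ne0$) with $J'(u)=0$, which satisfies the equation at every point of $\mathbb Z^3$, and for which $J(u)=m$ (in particular $m$ is finite). -/

import Mathlib

noncomputable section

namespace KirchhoffChoquard

/-- The vertex set of the lattice `ℤ³`. -/
abbrev Z3 : Type := Fin 3 → ℤ

/-- The lattice graph on `ℤ³`: `x ∼ y` iff `∑ |xᵢ - yᵢ| = 1`. -/
def lattice : SimpleGraph Z3 where
  Adj x y := ∑ i, |x i - y i| = 1
  symm := ⟨fun x y hxy => by simpa only [abs_sub_comm] using hxy⟩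
  loopless := ⟨fun x hx => by simp at hx⟩

instance latticeLocallyFinite : lattice.LocallyFinite := fun x =>
  Fintype.ofFinset ((Finset.Icc (x - 1) (x + 1)).filter fun y => ∑ i, |x i - y i| = 1) <| by
    intro y
    simp only [Finset.mem_filter, Finset.mem_Icc, SimpleGraph.mem_neighborSet, lattice,
      and_iff_right_iff_imp]
    intro hy
    have key : ∀ i, |x i - y i| ≤ 1 := fun i =>
      hy ▸ Finset.single_le_sum (f := fun i => |x i - y i|) (fun _ _ => abs_nonneg _)
        (Finset.mem_univ i)
    refine ⟨fun i => ?_, fun i => ?_⟩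
    · have := abs_le.1 (key i)
      simp only [Pi.sub_apply, Pi.one_apply]
      omega
    · have := abs_le.1 (key i)
      simp only [Pi.add_apply, Pi.one_apply]
      omega

/-- The discrete Laplacian `Δu(x) = ∑_{y ∼ x} (u(y) - u(x))`. -/
def laplacian (u : Z3 → ℝ) (x : Z3) : ℝ :=
  ∑ y ∈ lattice.neighborFinset x, (u y - u x)

/-- The gradient form
`(∇u ∇v)(x) = Γ(u, v)(x) = ½ ∑_{y ∼ x} (u(y) - u(x)) (v(y) - v(x))`;
thus `|∇u|²(x) = gradForm u u x`. -/
def gradForm (u v : Z3 → ℝ) (x : Z3) : ℝ :=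
  (1 / 2) * ∑ y ∈ lattice.neighborFinset x, (u y - u x) * (v y - v x)

/-- The Dirichlet energy `∫ |∇u|² dμ`. -/
def dirichletEnergy (u : Z3 → ℝ) : ℝ := ∑' x, gradForm u u x

/-- The symbol `μ(k) = 6 - 2 ∑ⱼ cos kⱼ` of the discrete Laplacian. -/
def symbol (k : Fin 3 → ℝ) : ℝ := 6 - 2 * ∑ j, Real.cos (k j)

/-- The torus `[0, 2π]³`. -/
def torus : Set (Fin 3 → ℝ) := Set.Icc 0 (fun _ => 2 * Real.pi)

/-- The fractional degree `K_α = (2π)⁻³ ∫_{𝕋³} μ(k)^{α/2} dk`. -/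
def fracDegree (α : ℝ) : ℝ :=
  (1 / (2 * Real.pi) ^ 3) * ∫ k in torus, symbol k ^ (α / 2)

/-- `K_α (2π)⁻³ ∫_{𝕋³} e^{i (x-y)·k} μ(k)^{-α/2} dk`, as a complex number. -/
def complexGreen (α : ℝ) (x y : Z3) : ℂ :=
  ((fracDegree α / (2 * Real.pi) ^ 3 : ℝ) : ℂ) *
    ∫ k in torus, Complex.exp (Complex.I * ((∑ j, ((x j - y j : ℤ) : ℝ) * k j : ℝ) : ℂ)) *
      ((symbol k ^ (-α / 2) : ℝ) : ℂ)

/-- The Green's function `R_α` of the discrete fractional Laplacian, as a real number; the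
imaginary part of `complexGreen` vanishes, see `complexGreen_eq`. -/
def green (α : ℝ) (x y : Z3) : ℝ := (complexGreen α x y).re

/-- The convolution `(R_α ∗ f)(x) = ∑_y R_α(x, y) f(y)`. -/
def greenConv (α : ℝ) (f : Z3 → ℝ) (x : Z3) : ℝ := ∑' y, green α x y * f y

theorem complexGreen_eq (α : ℝ) (x y : Z3) : complexGreen α x y = (green α x y : ℂ) := by
  have key : (starRingEnd ℂ) (complexGreen α x y) = complexGreen α x y := by
    unfold complexGreen
    rw [map_mul, Complex.conj_ofReal, ← integral_conj]
    congr 1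
    have hmp : MeasureTheory.MeasurePreserving
        (fun k : Fin 3 → ℝ => (fun _ => 2 * Real.pi) - k) MeasureTheory.volume
        MeasureTheory.volume := MeasureTheory.Measure.measurePreserving_sub_left _ _
    have hemb : MeasurableEmbedding (fun k : Fin 3 → ℝ => (fun _ => 2 * Real.pi) - k) :=
      (MeasurableEquiv.subLeft (fun _ : Fin 3 => 2 * Real.pi)).measurableEmbedding
    have hpre : (fun k : Fin 3 → ℝ => (fun _ => 2 * Real.pi) - k) ⁻¹' torus = torus := by
      ext k
      simp only [torus, Set.mem_preimage, Set.mem_Icc, sub_nonneg, sub_le_self_iff, and_comm]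
    rw [← hmp.setIntegral_preimage_emb hemb _ torus, hpre]
    congr 1
    funext k
    have hs : symbol ((fun _ => 2 * Real.pi) - k) = symbol k := by
      simp [symbol, Real.cos_two_pi_sub]
    rw [hs, map_mul, Complex.conj_ofReal, ← Complex.exp_conj, map_mul, Complex.conj_I,
      Complex.conj_ofReal]
    congr 1
    rw [Complex.exp_eq_exp_iff_exists_int]
    refine ⟨-∑ j, (x j - y j), ?_⟩
    push_cast
    simp only [Pi.sub_apply, Complex.ofReal_sub, Complex.ofReal_mul, Complex.ofReal_ofNat,
      mul_sub, Finset.sum_sub_distrib, Fin.sum_univ_succ, Fin.sum_univ_zero]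
    ring
  exact (Complex.conj_eq_iff_re.1 key).symm

/-! ### The spaces `H¹` and `H` -/

/-- The density of the squared `H¹` norm, `|∇u|² + u²`. -/
def h1Density (u : Z3 → ℝ) (x : Z3) : ℝ := gradForm u u x + u x ^ 2

/-- Membership in `H¹(ℤ³)`, the completion of the finitely supported functions in the norm
`(∫ (|∇u|² + u²) dμ)^{1/2}`, realized as a space of functions: `u` is approximated in this norm
by finitely supported functions. -/
def MemH1 (u : Z3 → ℝ) : Prop :=
  ∀ ε > 0, ∃ v : Z3 → ℝ, v.support.Finite ∧
    Summable (h1Density (u - v)) ∧ ∑' x, h1Density (u - v) x < ε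

theorem gradForm_self_nonneg (u : Z3 → ℝ) (x : Z3) : 0 ≤ gradForm u u x :=
  mul_nonneg (by norm_num) (Finset.sum_nonneg fun _ _ => mul_self_nonneg _)

theorem neighborFinset_eq (x : Z3) :
    lattice.neighborFinset x = (lattice.neighborFinset 0).map (addLeftEmbedding x) := by
  ext y
  simp only [SimpleGraph.mem_neighborFinset, Finset.mem_map, addLeftEmbedding_apply]
  constructor
  · intro hy
    refine ⟨y - x, ?_, by abel⟩
    simp only [lattice, Pi.zero_apply, Pi.sub_apply] at hy ⊢
    simpa using hy
  · rintro ⟨d, hd, rfl⟩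
    simp only [lattice, Pi.zero_apply, Pi.add_apply] at hd ⊢
    simpa using hd

theorem summable_neighbor_sum {f : Z3 → ℝ} (hf : Summable f) :
    Summable fun x => ∑ y ∈ lattice.neighborFinset x, f y := by
  have : (fun x => ∑ y ∈ lattice.neighborFinset x, f y) =
      fun x => ∑ d ∈ lattice.neighborFinset 0, f (x + d) := by
    funext x
    rw [neighborFinset_eq x, Finset.sum_map]
    rfl
  rw [this]
  exact summable_sum fun d _ => (Equiv.addRight d).summable_iff.2 hf

theorem card_neighborFinset (x : Z3) :
    (lattice.neighborFinset x).card = (lattice.neighborFinset 0).card := by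
  rw [neighborFinset_eq x, Finset.card_map]

theorem summable_gradForm_self {u : Z3 → ℝ} (hu : Summable fun x => u x ^ 2) :
    Summable (gradForm u u) := by
  refine Summable.of_nonneg_of_le (gradForm_self_nonneg u) (fun x => ?_)
    ((summable_neighbor_sum hu).add
      (hu.mul_left ((lattice.neighborFinset (0 : Z3)).card : ℝ)))
  have h1 : ∑ y ∈ lattice.neighborFinset x, (u y - u x) * (u y - u x) ≤
      ∑ y ∈ lattice.neighborFinset x, (2 * u y ^ 2 + 2 * u x ^ 2) :=
    Finset.sum_le_sum fun y _ => by nlinarith [sq_nonneg (u y + u x)]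
  rw [Finset.sum_add_distrib, ← Finset.mul_sum, Finset.sum_const, card_neighborFinset,
    nsmul_eq_mul] at h1
  unfold gradForm
  linarith

theorem summable_mul_of_sq {ι : Type*} {f g : ι → ℝ} (hf : Summable fun x => f x ^ 2)
    (hg : Summable fun x => g x ^ 2) : Summable fun x => f x * g x := by
  refine Summable.of_norm_bounded (hf.add hg) fun x => ?_
  rw [Real.norm_eq_abs, abs_le]
  constructor <;> nlinarith [sq_nonneg (f x + g x), sq_nonneg (f x - g x)]

theorem gradForm_add_left (u v w : Z3 → ℝ) (x : Z3) :
    gradForm (u + v) w x = gradForm u w x + gradForm v w x := by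
  simp only [gradForm, Pi.add_apply, ← mul_add, ← Finset.sum_add_distrib]
  congr 1
  exact Finset.sum_congr rfl fun _ _ => by ring

theorem gradForm_smul_left (c : ℝ) (u w : Z3 → ℝ) (x : Z3) :
    gradForm (c • u) w x = c * gradForm u w x := by
  simp only [gradForm, Pi.smul_apply, smul_eq_mul, Finset.mul_sum]
  exact Finset.sum_congr rfl fun _ _ => by ring

theorem gradForm_comm (u v : Z3 → ℝ) (x : Z3) : gradForm u v x = gradForm v u x := by
  simp only [gradForm]
  congr 1
  exact Finset.sum_congr rfl fun _ _ => by ring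

theorem summable_add_sq {ι : Type*} {f g : ι → ℝ} (hf : Summable fun x => f x ^ 2)
    (hg : Summable fun x => g x ^ 2) : Summable fun x => (f x + g x) ^ 2 := by
  have := (hf.add ((summable_mul_of_sq hf hg).mul_left 2)).add hg
  refine this.congr fun x => by ring

theorem summable_gradForm {u v : Z3 → ℝ} (hu : Summable fun x => u x ^ 2)
    (hv : Summable fun x => v x ^ 2) : Summable (gradForm u v) := by
  have h := ((summable_gradForm_self (u := u + v) (summable_add_sq hu hv)).sub
    ((summable_gradForm_self hu).add (summable_gradForm_self hv))).mul_left (1 / 2)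
  refine h.congr fun x => ?_
  rw [gradForm_add_left, gradForm_comm u (u + v), gradForm_comm v (u + v), gradForm_add_left,
    gradForm_add_left, gradForm_comm v u]
  ring

theorem memH1_iff {u : Z3 → ℝ} : MemH1 u ↔ Summable fun x => u x ^ 2 := by
  classical
  constructor
  · intro hu
    obtain ⟨v, hv, hs, -⟩ := hu 1 one_pos
    have h1 : Summable fun x => (u - v) x ^ 2 :=
      Summable.of_nonneg_of_le (fun _ => sq_nonneg _)
        (fun x => le_add_of_nonneg_left (gradForm_self_nonneg _ _)) hs
    have h2 : Summable fun x => v x ^ 2 :=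
      summable_of_hasFiniteSupport (hv.subset fun x hx => by
        simp only [Function.mem_support] at hx ⊢
        exact fun h0 => hx (by simp [h0]))
    exact (summable_add_sq h1 h2).congr fun x => by simp
  · intro hu ε hε
    have hA : Summable fun x => ∑ y ∈ lattice.neighborFinset x, u y ^ 2 :=
      summable_neighbor_sum hu
    have hd : ∀ w : Z3 → ℝ, (Summable fun x => w x ^ 2) → Summable (h1Density w) :=
      fun w hw => (summable_gradForm_self hw).add hw
    set N : ℝ := ((lattice.neighborFinset (0 : Z3)).card : ℝ) with hN
    have hbound : ∀ w : Z3 → ℝ, (Summable fun x => w x ^ 2) →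
        ∑' x, h1Density w x ≤ (2 * N + 1) * ∑' x, w x ^ 2 := by
      intro w hw
      have hle : ∀ x, h1Density w x ≤
          (∑ d ∈ lattice.neighborFinset (0 : Z3), w (x + d) ^ 2) + (N + 1) * w x ^ 2 := by
        intro x
        have h1 : ∑ y ∈ lattice.neighborFinset x, (w y - w x) * (w y - w x) ≤
            ∑ y ∈ lattice.neighborFinset x, (2 * w y ^ 2 + 2 * w x ^ 2) :=
          Finset.sum_le_sum fun y _ => by nlinarith [sq_nonneg (w y + w x)]
        rw [Finset.sum_add_distrib, ← Finset.mul_sum, Finset.sum_const, card_neighborFinset,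
          nsmul_eq_mul, neighborFinset_eq x, Finset.sum_map, Finset.sum_map] at h1
        simp only [addLeftEmbedding_apply] at h1
        unfold h1Density gradForm
        rw [neighborFinset_eq x, Finset.sum_map]
        simp only [addLeftEmbedding_apply]
        linarith
      have hsh : ∀ d : Z3, Summable fun x => w (x + d) ^ 2 := fun d =>
        (Equiv.addRight d).summable_iff.2 hw
      have hR := (summable_sum (s := lattice.neighborFinset (0 : Z3))
        (fun d _ => hsh d))
      refine ((hd w hw).tsum_le_tsum hle (hR.add (hw.mul_left _))).trans (le_of_eq ?_)
      rw [hR.tsum_add (hw.mul_left _), tsum_mul_left,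
        Summable.tsum_finsetSum (fun d _ => hsh d)]
      have : ∀ d : Z3, ∑' x, w (x + d) ^ 2 = ∑' x, w x ^ 2 := fun d =>
        (Equiv.addRight d).tsum_eq (fun x => w x ^ 2)
      simp only [this, Finset.sum_const, nsmul_eq_mul]
      ring
    have hN0 : 0 ≤ N := Nat.cast_nonneg _
    obtain ⟨s, hs⟩ := ((tendsto_order.1 (tendsto_tsum_compl_atTop_zero fun x => u x ^ 2)).2
      (ε / (2 * N + 1)) (by positivity)).exists
    refine ⟨fun x => if x ∈ s then u x else 0, s.finite_toSet.subset ?_, ?_, ?_⟩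
    · intro x hx
      by_contra hxs
      exact hx (if_neg hxs)
    all_goals
      have hw : ∀ x, (u - fun x => if x ∈ s then u x else 0) x ^ 2 =
          (({x | x ∉ s} : Set Z3).indicator (fun x => u x ^ 2)) x := by
        intro x
        by_cases hx : x ∈ s <;> simp [hx]
      have hws : Summable fun x => (u - fun x => if x ∈ s then u x else 0) x ^ 2 :=
        (hu.indicator {x | x ∉ s}).congr fun x => (hw x).symm
    · exact hd _ hws
    · refine (hbound _ hws).trans_lt ?_
      simp only [hw]
      rw [← tsum_subtype ({x | x ∉ s} : Set Z3) (fun x => u x ^ 2)]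
      have h2 := (lt_div_iff₀ (by positivity)).1 hs
      calc _ = _ := mul_comm _ _
        _ < ε := h2

/-- The potential is bounded below by a positive constant: `h ≥ h₀ > 0`. -/
def UniformlyPositive (h : Z3 → ℝ) : Prop := ∃ h₀ > 0, ∀ x, h₀ ≤ h x

/-- The potential is coercive: for some `x₀`, `h(x) → ∞` as `|x - x₀| → ∞`, where `|x - x₀|` is
the graph distance. -/
def Coercive (h : Z3 → ℝ) : Prop :=
  ∃ x₀ : Z3, ∀ M : ℝ, ∃ r : ℕ, ∀ x, r ≤ lattice.dist x x₀ → M ≤ h x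

theorem UniformlyPositive.nonneg {h : Z3 → ℝ} (hh : UniformlyPositive h) (x : Z3) : 0 ≤ h x := by
  obtain ⟨h₀, h0, hle⟩ := hh
  exact h0.le.trans (hle x)

theorem summable_weighted_mul {h u v : Z3 → ℝ} (hh : UniformlyPositive h)
    (hu : Summable fun x => h x * u x ^ 2) (hv : Summable fun x => h x * v x ^ 2) :
    Summable fun x => h x * u x * v x := by
  have hsq : ∀ w : Z3 → ℝ, (Summable fun x => h x * w x ^ 2) →
      Summable fun x => (√(h x) * w x) ^ 2 := fun w hw =>
    hw.congr fun x => by rw [mul_pow, Real.sq_sqrt (hh.nonneg x)]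
  refine (summable_mul_of_sq (hsq u hu) (hsq v hv)).congr fun x => ?_
  have := Real.mul_self_sqrt (hh.nonneg x)
  calc _ = (√(h x) * √(h x)) * u x * v x := by ring
    _ = _ := by rw [this]

/-- The linear space `{u ∈ H¹(ℤ³) : ∫ h u² dμ < ∞}`. -/
def hSubmodule {h : Z3 → ℝ} (hh : UniformlyPositive h) : Submodule ℝ (Z3 → ℝ) where
  carrier := {u | MemH1 u ∧ Summable fun x => h x * u x ^ 2}
  zero_mem' := by
    refine ⟨memH1_iff.2 ?_, ?_⟩ <;> simp
  add_mem' := by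
    rintro u v ⟨hu1, hu2⟩ ⟨hv1, hv2⟩
    refine ⟨memH1_iff.2 (summable_add_sq (memH1_iff.1 hu1) (memH1_iff.1 hv1)), ?_⟩
    refine ((hu2.add hv2).add ((summable_weighted_mul hh hu2 hv2).mul_left 2)).congr fun x => ?_
    simp only [Pi.add_apply]
    ring
  smul_mem' := by
    rintro c u ⟨hu1, hu2⟩
    refine ⟨memH1_iff.2 (((memH1_iff.1 hu1).mul_left (c ^ 2)).congr fun x => ?_),
      (hu2.mul_left (c ^ 2)).congr fun x => ?_⟩ <;>
    · simp only [Pi.smul_apply, smul_eq_mul]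
      ring

/-- The space `H`, which carries the inner product
`⟪u, v⟫ = ∫ (a ∇u ∇v + h u v) dμ` defined below (hence the dependence on `a`). -/
def HSpace {a : ℝ} {h : Z3 → ℝ} (_ha : 0 < a) (hh : UniformlyPositive h) : Type :=
  hSubmodule hh

section HSpace

variable {a : ℝ} {h : Z3 → ℝ} {ha : 0 < a} {hh : UniformlyPositive h}

instance : AddCommGroup (HSpace ha hh) := inferInstanceAs (AddCommGroup (hSubmodule hh))

instance : Module ℝ (HSpace ha hh) := inferInstanceAs (Module ℝ (hSubmodule hh))

instance : CoeFun (HSpace ha hh) (fun _ => Z3 → ℝ) := ⟨fun u => u.1⟩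

/-- The inner product of `H`. -/
def innerH (u v : HSpace ha hh) : ℝ := ∑' x, (a * gradForm u v x + h x * u x * v x)

theorem HSpace.summable_sq (u : HSpace ha hh) : Summable fun x => u x ^ 2 := memH1_iff.1 u.2.1

theorem HSpace.summable_inner (u v : HSpace ha hh) :
    Summable fun x => a * gradForm u v x + h x * u x * v x :=
  ((summable_gradForm u.summable_sq v.summable_sq).mul_left a).add
    (summable_weighted_mul hh u.2.2 v.2.2)

theorem HSpace.inner_term_nonneg (u : HSpace ha hh) (x : Z3) :
    0 ≤ a * gradForm u u x + h x * u x * u x := by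
  have h1 := mul_nonneg ha.le (gradForm_self_nonneg u x)
  have h2 := mul_nonneg (hh.nonneg x) (mul_self_nonneg (u x))
  linarith

/-- The inner product space structure of `H`. -/
@[reducible] def hCore : InnerProductSpace.Core ℝ (HSpace ha hh) where
  inner := innerH
  conj_inner_symm u v := by
    simp only [conj_trivial, innerH]
    exact tsum_congr fun x => by rw [gradForm_comm]; ring
  re_inner_nonneg u := tsum_nonneg u.inner_term_nonneg
  add_left u v w := by
    simp only [innerH]
    rw [← (u.summable_inner w).tsum_add (v.summable_inner w)]
    refine tsum_congr fun x => ?_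
    rw [show ((u + v : HSpace ha hh) : Z3 → ℝ) = (u : Z3 → ℝ) + v from rfl, gradForm_add_left,
      Pi.add_apply]
    ring
  smul_left u v c := by
    simp only [innerH, conj_trivial]
    rw [← tsum_mul_left]
    refine tsum_congr fun x => ?_
    rw [show ((c • u : HSpace ha hh) : Z3 → ℝ) = c • (u : Z3 → ℝ) from rfl, gradForm_smul_left,
      Pi.smul_apply, smul_eq_mul]
    ring
  definite u hu := by
    have h0 := (hasSum_zero_iff_of_nonneg u.inner_term_nonneg).1
      ((u.summable_inner u).hasSum_iff.2 hu)
    refine Subtype.ext (funext fun x => ?_)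
    have hx := congrFun h0 x
    simp only [Pi.zero_apply] at hx
    have hex := hh
    obtain ⟨h₀, hpos, hle⟩ := hex
    have h1 := mul_nonneg ha.le (gradForm_self_nonneg u x)
    have h2 := mul_le_mul_of_nonneg_right (hle x) (mul_self_nonneg (u x))
    have h3 : u x * u x = 0 := by
      have := mul_self_nonneg (u x)
      nlinarith
    exact mul_self_eq_zero.1 h3

instance : NormedAddCommGroup (HSpace ha hh) :=
  @InnerProductSpace.Core.toNormedAddCommGroup ℝ _ _ _ _ hCore

instance : InnerProductSpace ℝ (HSpace ha hh) := InnerProductSpace.ofCore hCore.toCore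

theorem memH_of_abs_le (u : HSpace ha hh) {v : Z3 → ℝ} (hv : ∀ x, |v x| ≤ |u x|) :
    v ∈ hSubmodule hh :=
  ⟨memH1_iff.2 (Summable.of_nonneg_of_le (fun _ => sq_nonneg _)
      (fun x => sq_le_sq.2 (hv x)) u.summable_sq),
    Summable.of_nonneg_of_le (fun x => mul_nonneg (hh.nonneg x) (sq_nonneg _))
      (fun x => mul_le_mul_of_nonneg_left (sq_le_sq.2 (hv x)) (hh.nonneg x)) u.2.2⟩

/-- The positive part `u⁺ = max {u, 0}`. -/
def HSpace.pos (u : HSpace ha hh) : HSpace ha hh :=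
  ⟨fun x => max (u x) 0, memH_of_abs_le u fun x => by
    rcases le_total (u x) 0 with h0 | h0 <;> simp [h0]⟩

/-- The negative part `u⁻ = min {u, 0}`; it is nonpositive, and `u = u⁺ + u⁻`. -/
def HSpace.neg (u : HSpace ha hh) : HSpace ha hh :=
  ⟨fun x => min (u x) 0, memH_of_abs_le u fun x => by
    rcases le_total (u x) 0 with h0 | h0 <;> simp [h0]⟩

/-- The energy functional
`J(u) = ½ ∫ (a |∇u|² + h u²) dμ + (b/4) (∫ |∇u|² dμ)² - (1/(2p)) ∫ (R_α ∗ |u|^p) |u|^p dμ`. -/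
def energy (b α p : ℝ) (u : HSpace ha hh) : ℝ :=
  (1 / 2) * ∑' x, (a * gradForm u u x + h x * u x ^ 2)
    + (b / 4) * dirichletEnergy u ^ 2
    - (1 / (2 * p)) * ∑' x, greenConv α (fun y => |u y| ^ p) x * |u x| ^ p

/-- The sign-changing Nehari manifold
`ℳ = {u ∈ H : u⁺ ≠ 0, u⁻ ≠ 0, (J'(u), u⁺) = (J'(u), u⁻) = 0}`, with `J'` the Fréchet
derivative of `J` on `H`. -/
def signChangingNehari (ha : 0 < a) (hh : UniformlyPositive h) (b α p : ℝ) :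
    Set (HSpace ha hh) :=
  {u | u.pos ≠ 0 ∧ u.neg ≠ 0 ∧
    fderiv ℝ (energy b α p) u u.pos = 0 ∧ fderiv ℝ (energy b α p) u u.neg = 0}

end HSpace

/-- The Kirchhoff–Choquard equation
`-(a + b ∫ |∇u|² dμ) Δu + h u = (R_α ∗ |u|^p) |u|^{p-2} u` at every point of `ℤ³`. -/
def SolvesEquation (a b α p : ℝ) (h u : Z3 → ℝ) : Prop :=
  ∀ x, -(a + b * dirichletEnergy u) * laplacian u x + h x * u x =
    greenConv α (fun y => |u y| ^ p) x * |u x| ^ (p - 2) * u x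

end KirchhoffChoquard

end

open KirchhoffChoquard

noncomputable section

namespace KirchhoffChoquard

open MeasureTheory Set Real Filter Topology

/-! ### The symbol and the Green's function -/

/-! No manifold structure on the Nehari set `ℳ` is used. The proof works with the two-parameter
fibres `(s, t) ↦ J(s u⁺ + t u⁻)`, `s, t ≥ 0`, written `energy b α p (comb s t u)`.

Fibering. In the variables `S = s^p`, `T = t^p` a fibre is concave: the Choquard term is a positive
semidefinite quadratic form in `(S, T)` entering with a minus sign, while the remaining terms have
nonnegative coefficients and total degree 2 or 4 in `(s, t)`, hence are concave in `(S, T)` because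
`p > 4`. For `u ∈ ℳ` the point `(1, 1)` is critical, so it is the global maximum;
`fibering_inequality` proves this by tangent lines and keeps a surplus that makes the maximum
strict. Conversely, if `u⁺` and `u⁻` are both nonzero, the fibre has a maximum with `s, t > 0`, and
that point lies in `ℳ` (`exists_comb_mem_signChangingNehari`): near the axes a quadratic gain wins,
and far out the Choquard term wins. Both uses of the Green's form rest on
`greenLower_mul_sum_sq_le`, that is, on the Fourier multiplier `ω^{-α/2}` being at least
`12^{-α/2}`; no pointwise sign of `R_α` is needed.

Minimization. The kernel `R_α` is bounded because `α < 3`, and `|u|^p` is summable for `u ∈ ℓ²`, so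
every part of `J` except `½‖u‖²` is continuous on `ℓ²`. Coercivity of `h` makes `H → ℓ²` compact. A
minimizing sequence is bounded since `J ≥ ¼‖u‖²` on `ℳ`; it converges in `ℓ²` to some `v` along a
subsequence, and the Nehari identities keep both parts of `v` nonzero. Projecting `v` to `s v⁺ + t
v⁻ ∈ ℳ` and comparing with `s uₙ⁺ + t uₙ⁻`, whose energy is at most `J(uₙ)`, gives a minimizer
(`exists_minimizer`).

Criticality. If `J'(w) φ < 0` at a minimizer `w`, then for small `ε > 0` the fibre of `w + ε φ`
still has an interior maximum near `(1, 1)`, hence a point of `ℳ`. Strict differentiability of `J`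
at `w` shows that its energy is below `J(w)`, a contradiction (`energyDeriv_nonneg_of_minimizer`).
Testing `J'(w) = 0` with point masses yields the equation. -/

theorem symbol_eq_sum (k : Fin 3 → ℝ) : symbol k = ∑ j, (2 - 2 * cos (k j)) := by
  simp only [symbol, Fin.sum_univ_three]
  ring

theorem symbol_nonneg (k : Fin 3 → ℝ) : 0 ≤ symbol k := by
  rw [symbol_eq_sum]
  exact Finset.sum_nonneg fun j _ => by linarith [cos_le_one (k j)]

theorem symbol_le (k : Fin 3 → ℝ) : symbol k ≤ 12 := by
  simp only [symbol, Fin.sum_univ_three]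
  linarith [neg_one_le_cos (k 0), neg_one_le_cos (k 1), neg_one_le_cos (k 2)]

theorem continuous_symbol : Continuous symbol := by
  unfold symbol
  fun_prop

theorem torus_eq_pi : torus = Set.pi univ fun _ => Icc 0 (2 * π) := by
  ext k
  simp [torus, Set.mem_Icc, Pi.le_def]

theorem isCompact_torus : IsCompact torus := isCompact_Icc

theorem restrict_torus :
    (volume : Measure (Fin 3 → ℝ)).restrict torus =
      Measure.pi fun _ => (volume : Measure ℝ).restrict (Icc 0 (2 * π)) := by
  rw [torus_eq_pi, volume_pi, Measure.restrict_pi_pi]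

/-- Bounds on negative powers of `symbol` need a strictly positive base, since `0 ^ γ = 0` for real
`γ ≠ 0`. The faces of the cube, where some `2 - 2 cos kⱼ` vanishes, are null. -/
theorem ae_torus_mem_Ioo :
    ∀ᵐ k ∂(volume : Measure (Fin 3 → ℝ)).restrict torus, ∀ j, k j ∈ Ioo 0 (2 * π) := by
  have h : (volume : Measure (Fin 3 → ℝ)).restrict torus =
      volume.restrict (Set.pi univ fun _ => Ioo 0 (2 * π)) :=
    (Measure.restrict_congr_set (Measure.univ_pi_Ioo_ae_eq_Icc (μ := fun _ : Fin 3 => volume)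
      (f := fun _ => (0 : ℝ)) (g := fun _ => 2 * π))).symm
  rw [h, ae_restrict_iff' (MeasurableSet.univ_pi fun _ => measurableSet_Ioo)]
  exact ae_of_all _ fun k hk j => hk j (mem_univ j)

theorem two_sub_two_cos_pos {x : ℝ} (hx : x ∈ Ioo 0 (2 * π)) : 0 < 2 - 2 * cos x := by
  have h1 : cos x ≠ 1 := fun h => by
    rw [cos_eq_one_iff_of_lt_of_lt (by linarith [hx.1, pi_pos]) hx.2] at h
    exact hx.1.ne' h
  have := lt_of_le_of_ne (cos_le_one x) h1
  linarith

/-- The zeros at both endpoints are quadratic, so the integrand is dominated by the power `-2γ > -1`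
of the distance to an endpoint. -/
theorem integrableOn_two_sub_two_cos_rpow {γ : ℝ} (hγ₀ : 0 < γ) (hγ : γ < 1 / 2) :
    IntegrableOn (fun x => (2 - 2 * cos x) ^ (-γ)) (Icc 0 (2 * π)) := by
  rw [integrableOn_Icc_iff_integrableOn_Ioo]
  have hpi := pi_pos
  have h1 : IntervalIntegrable (fun x : ℝ => x ^ (-(2 * γ))) volume 0 (2 * π) :=
    intervalIntegral.intervalIntegrable_rpow' (by linarith)
  have h2 : IntervalIntegrable (fun x : ℝ => (2 * π - x) ^ (-(2 * γ))) volume 0 (2 * π) := by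
    simpa using (h1.comp_sub_left (2 * π)).symm
  have h3 := ((h1.add h2).const_mul ((4 / π ^ 2) ^ (-γ))).1.mono_set Ioo_subset_Ioc_self
  refine Integrable.mono' h3 ?_ ?_
  · refine Measurable.aestronglyMeasurable ?_
    fun_prop
  · refine (ae_restrict_iff' measurableSet_Ioo).2 (ae_of_all _ fun x hx => ?_)
    have hpos := two_sub_two_cos_pos hx
    rw [norm_of_nonneg (rpow_nonneg hpos.le _)]
    have hx2 : 0 < 2 * π - x := by linarith [hx.2]
    -- Here `y` is the distance from `x` to the nearer endpoint: `x` itself, or `2π - x` by symmetry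
    -- of the cosine.
    have key : ∀ y : ℝ, 0 < y → y ≤ π → cos x = cos y →
        (2 - 2 * cos x) ^ (-γ) ≤ (4 / π ^ 2) ^ (-γ) * y ^ (-(2 * γ)) := by
      intro y hy hyp hc
      have hb := cos_le_one_sub_mul_cos_sq (x := y) (by rwa [abs_of_pos hy])
      have hle : 4 / π ^ 2 * y ^ 2 ≤ 2 - 2 * cos x := by
        rw [hc]
        have : 4 / π ^ 2 * y ^ 2 = 2 * (2 / π ^ 2 * y ^ 2) := by ring
        linarith
      calc (2 - 2 * cos x) ^ (-γ) ≤ (4 / π ^ 2 * y ^ 2) ^ (-γ) :=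
            rpow_le_rpow_of_nonpos (by positivity) hle (by linarith)
        _ = (4 / π ^ 2) ^ (-γ) * y ^ (-(2 * γ)) := by
            rw [mul_rpow (by positivity) (by positivity), ← rpow_natCast y 2, ← rpow_mul hy.le]
            congr 2
            push_cast
            ring
    have hC : 0 < (4 / π ^ 2) ^ (-γ) := by positivity
    have ha := rpow_nonneg hx.1.le (-(2 * γ))
    have hb := rpow_nonneg hx2.le (-(2 * γ))
    simp only [mul_add]
    rcases le_total x π with hxp | hxp
    · exact (key x hx.1 hxp rfl).trans (le_add_of_nonneg_right (by positivity))
    · refine (key (2 * π - x) hx2 (by linarith) (cos_two_pi_sub x).symm).trans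
        (le_add_of_nonneg_left (by positivity))

/-- Since `ω` dominates each of its three summands, `ω³` dominates their product and `ω^{-α/2} ≤ ∏ⱼ
(2 - 2 cos kⱼ)^{-α/6}`. Fubini reduces the claim to one variable, where `α / 6 < 1 / 2` is the
condition `α < 3`. -/
theorem integrableOn_symbol_rpow_neg {α : ℝ} (hα₀ : 0 < α) (hα₃ : α < 3) :
    IntegrableOn (fun k => symbol k ^ (-α / 2)) torus := by
  have h1 := Integrable.fintype_prod (fun _ : Fin 3 =>
    (integrableOn_two_sub_two_cos_rpow (γ := α / 6) (by linarith) (by linarith) :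
      Integrable _ (volume.restrict _)))
  rw [← restrict_torus] at h1
  refine Integrable.mono' h1 ?_ ?_
  · exact (continuous_symbol.measurable.pow_const _).aestronglyMeasurable
  · filter_upwards [ae_torus_mem_Ioo] with k hk
    have hpos := fun j => two_sub_two_cos_pos (hk j)
    rw [norm_of_nonneg (rpow_nonneg (symbol_nonneg k) _)]
    have hle : ∀ j, 2 - 2 * cos (k j) ≤ symbol k := fun j => by
      rw [symbol_eq_sum]
      exact Finset.single_le_sum (f := fun j => 2 - 2 * cos (k j)) (fun i _ => (hpos i).le)
        (Finset.mem_univ j)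
    have hprod : ∏ j, (2 - 2 * cos (k j)) ≤ symbol k ^ (3 : ℝ) := by
      refine (Finset.prod_le_prod (fun j _ => (hpos j).le) fun j _ => hle j).trans (le_of_eq ?_)
      rw [Finset.prod_const, Finset.card_univ, Fintype.card_fin]
      exact_mod_cast rfl
    calc symbol k ^ (-α / 2) = (symbol k ^ (3 : ℝ)) ^ (-(α / 6)) := by
          rw [← rpow_mul (symbol_nonneg k)]
          congr 1
          ring
      _ ≤ (∏ j, (2 - 2 * cos (k j))) ^ (-(α / 6)) :=
          rpow_le_rpow_of_nonpos (Finset.prod_pos fun j _ => hpos j) hprod (by linarith)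
      _ = ∏ j, (2 - 2 * cos (k j)) ^ (-(α / 6)) :=
          (Real.finsetProd_rpow _ _ (fun j _ => (hpos j).le) _).symm

theorem fracDegree_pos {α : ℝ} (hα₀ : 0 < α) : 0 < fracDegree α := by
  refine mul_pos (by positivity) ?_
  have hcont : Continuous fun k => symbol k ^ (α / 2) :=
    continuous_symbol.rpow_const fun _ => Or.inr (by linarith)
  rw [setIntegral_pos_iff_support_of_nonneg_ae
    (ae_of_all _ fun k => rpow_nonneg (symbol_nonneg k) _)
    (hcont.continuousOn.integrableOn_compact isCompact_torus)]
  have hsub : (Set.pi univ fun _ : Fin 3 => Ioo 0 (2 * π)) ⊆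
      (Function.support fun k => symbol k ^ (α / 2)) ∩ torus := by
    intro k hk
    refine ⟨(rpow_pos_of_pos ?_ _).ne', ?_⟩
    · rw [symbol_eq_sum]
      exact Finset.sum_pos (fun j _ => two_sub_two_cos_pos (hk j (mem_univ j)))
        Finset.univ_nonempty
    · rw [torus_eq_pi]
      exact fun j hj => Ioo_subset_Icc_self (hk j hj)
  refine lt_of_lt_of_le ?_ (measure_mono hsub)
  rw [volume_pi_pi]
  have : 0 < ENNReal.ofReal π := ENNReal.ofReal_pos.2 pi_pos
  simp only [volume_Ioo, sub_zero, Finset.prod_const, ENNReal.ofReal_mul zero_le_two]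
  positivity

/-- The phase `n ↦ n · k` on the lattice. -/
def phase (n : Z3) (k : Fin 3 → ℝ) : ℝ := ∑ j, (n j : ℝ) * k j

theorem phase_sub (x y : Z3) (k : Fin 3 → ℝ) : phase (x - y) k = phase x k - phase y k := by
  simp only [phase, Pi.sub_apply, Int.cast_sub, sub_mul, Finset.sum_sub_distrib]

theorem continuous_phase (n : Z3) : Continuous (phase n) := by
  unfold phase
  fun_prop

/-- The normalizing constant `K_α / (2π)³` of the Green's function. -/
def greenConst (α : ℝ) : ℝ := fracDegree α / (2 * π) ^ 3

theorem greenConst_pos {α : ℝ} (hα₀ : 0 < α) : 0 < greenConst α :=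
  div_pos (fracDegree_pos hα₀) (by positivity)

theorem integrableOn_cos_phase_mul {α : ℝ} (hα₀ : 0 < α) (hα₃ : α < 3) (n : Z3) :
    IntegrableOn (fun k => cos (phase n k) * symbol k ^ (-α / 2)) torus := by
  refine (integrableOn_symbol_rpow_neg hα₀ hα₃).bdd_mul (c := 1)
    (continuous_cos.comp (continuous_phase n)).aestronglyMeasurable
    (ae_of_all _ fun k => ?_)
  exact abs_cos_le_one _

theorem green_eq {α : ℝ} (hα₀ : 0 < α) (hα₃ : α < 3) (x y : Z3) :
    green α x y = greenConst α *
      ∫ k in torus, cos (phase (x - y) k) * symbol k ^ (-α / 2) := by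
  unfold green complexGreen
  rw [Complex.re_ofReal_mul]
  congr 1
  have hint : IntegrableOn (fun k : Fin 3 → ℝ =>
      Complex.exp (Complex.I * ((∑ j, ((x j - y j : ℤ) : ℝ) * k j : ℝ) : ℂ)) *
        ((symbol k ^ (-α / 2) : ℝ) : ℂ)) torus := by
    refine Integrable.bdd_mul (c := 1) (integrableOn_symbol_rpow_neg hα₀ hα₃).ofReal
      (Continuous.aestronglyMeasurable (by fun_prop)) (ae_of_all _ fun k => ?_)
    rw [mul_comm, Complex.norm_exp_ofReal_mul_I]
  refine (integral_re hint).symm.trans (integral_congr_ae (ae_of_all _ fun k => ?_))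
  simp only [RCLike.re_eq_complex_re, Complex.re_mul_ofReal]
  rw [mul_comm Complex.I, Complex.exp_ofReal_mul_I_re]
  rfl

theorem green_comm {α : ℝ} (hα₀ : 0 < α) (hα₃ : α < 3) (x y : Z3) :
    green α x y = green α y x := by
  rw [green_eq hα₀ hα₃, green_eq hα₀ hα₃]
  congr 2
  funext k
  rw [phase_sub, phase_sub, ← cos_neg, neg_sub]

/-- A uniform bound for the Green's function. -/
def greenBound (α : ℝ) : ℝ := greenConst α * ∫ k in torus, symbol k ^ (-α / 2)

theorem abs_green_le {α : ℝ} (hα₀ : 0 < α) (hα₃ : α < 3) (x y : Z3) :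
    |green α x y| ≤ greenBound α := by
  rw [green_eq hα₀ hα₃, abs_mul, abs_of_pos (greenConst_pos hα₀)]
  refine mul_le_mul_of_nonneg_left ?_ (greenConst_pos hα₀).le
  rw [← norm_eq_abs]
  refine norm_integral_le_of_norm_le (integrableOn_symbol_rpow_neg hα₀ hα₃)
    (ae_of_all _ fun k => ?_)
  rw [norm_mul, norm_of_nonneg (rpow_nonneg (symbol_nonneg k) _)]
  exact mul_le_of_le_one_left (rpow_nonneg (symbol_nonneg k) _) (abs_cos_le_one _)

/-! ### Orthogonality of characters and ellipticity of the Green's form. -/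

theorem integral_exp_int_mul (n : ℤ) :
    ∫ t in Icc 0 (2 * π), Complex.exp (Complex.I * (n * t : ℝ)) =
      if n = 0 then ((2 * π : ℝ) : ℂ) else 0 := by
  rw [integral_Icc_eq_integral_Ioc, ← intervalIntegral.integral_of_le (by positivity)]
  split_ifs with hn
  · simp [hn]
  · have h0 : Complex.I * n ≠ 0 := mul_ne_zero Complex.I_ne_zero (Int.cast_ne_zero.2 hn)
    have h1 := integral_exp_mul_complex (a := 0) (b := 2 * π) h0
    have h2 : Complex.exp (Complex.I * n * ((2 * π : ℝ) : ℂ)) = 1 := by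
      rw [Complex.exp_eq_one_iff]
      exact ⟨n, by push_cast; ring⟩
    rw [h2] at h1
    simp only [Complex.ofReal_mul, Complex.ofReal_intCast, ← mul_assoc] at h1 ⊢
    rw [h1]
    simp

theorem integral_cos_phase (n : Z3) :
    ∫ k in torus, cos (phase n k) = if n = 0 then (2 * π) ^ 3 else 0 := by
  have h1 : ∫ k in torus, Complex.exp (Complex.I * (phase n k : ℝ)) =
      ∏ j, if n j = 0 then ((2 * π : ℝ) : ℂ) else 0 := by
    rw [restrict_torus]
    simp only [← integral_exp_int_mul]
    rw [← integral_fintype_prod_eq_prod (μ := fun _ : Fin 3 => volume.restrict (Icc 0 (2 * π)))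
      (fun j t => Complex.exp (Complex.I * ((n j : ℝ) * t : ℝ)))]
    congr 1
    funext k
    rw [← Complex.exp_sum, phase]
    push_cast
    rw [Finset.mul_sum]
  have hint : IntegrableOn (fun k : Fin 3 → ℝ => Complex.exp (Complex.I * (phase n k : ℝ)))
      torus := by
    refine ContinuousOn.integrableOn_compact isCompact_torus (Continuous.continuousOn ?_)
    have := continuous_phase n
    fun_prop
  have h2 : ∫ k in torus, cos (phase n k) =
      (∫ k in torus, Complex.exp (Complex.I * (phase n k : ℝ))).re := by
    refine Eq.trans (integral_congr_ae (ae_of_all _ fun k => ?_)) (integral_re hint)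
    simp only [RCLike.re_eq_complex_re]
    rw [mul_comm Complex.I, Complex.exp_ofReal_mul_I_re]
  rw [h2, h1]
  split_ifs with hn
  · simp only [hn, Pi.zero_apply, if_true, Finset.prod_const, Finset.card_univ,
      Fintype.card_fin]
    exact_mod_cast Complex.ofReal_re _
  · obtain ⟨j, hj⟩ : ∃ j, n j ≠ 0 := by
      by_contra! h
      exact hn (funext h)
    rw [Finset.prod_eq_zero (Finset.mem_univ j) (if_neg hj), Complex.zero_re]

/-- The double sum is `|∑ f(x) e^{i x·k}|²`, split into its cosine and sine parts. -/
theorem sum_mul_cos_phase_sub_nonneg (s : Finset Z3) (f : Z3 → ℝ) (k : Fin 3 → ℝ) :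
    0 ≤ ∑ x ∈ s, ∑ y ∈ s, f x * f y * cos (phase (x - y) k) := by
  have : ∑ x ∈ s, ∑ y ∈ s, f x * f y * cos (phase (x - y) k) =
      (∑ x ∈ s, f x * cos (phase x k)) ^ 2 + (∑ x ∈ s, f x * sin (phase x k)) ^ 2 := by
    simp only [sq, Finset.sum_mul_sum, ← Finset.sum_add_distrib, phase_sub, cos_sub]
    exact Finset.sum_congr rfl fun x _ => Finset.sum_congr rfl fun y _ => by ring
  rw [this]
  positivity

/-- The ellipticity constant of the Green's form. -/
def greenLower (α : ℝ) : ℝ := greenConst α * (12 ^ (-α / 2) * (2 * π) ^ 3)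

theorem greenLower_pos {α : ℝ} (hα₀ : 0 < α) : 0 < greenLower α :=
  mul_pos (greenConst_pos hα₀) (by positivity)

/-- In Fourier variables the Green's form is `∫ |f̂|² ω^{-α/2}` up to a constant. Bounding the
multiplier below through `ω ≤ 12` leaves `∫ |f̂|²`, which is Parseval's sum of squares. -/
theorem greenLower_mul_sum_sq_le {α : ℝ} (hα₀ : 0 < α) (hα₃ : α < 3) (s : Finset Z3)
    (f : Z3 → ℝ) :
    greenLower α * ∑ x ∈ s, f x ^ 2 ≤ ∑ x ∈ s, ∑ y ∈ s, f x * f y * green α x y := by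
  have hcos : ∀ n : Z3, IntegrableOn (fun k => cos (phase n k)) torus := fun n =>
    (continuous_cos.comp (continuous_phase n)).continuousOn.integrableOn_compact isCompact_torus
  have hR : ∑ x ∈ s, ∑ y ∈ s, f x * f y * green α x y = greenConst α *
      ∫ k in torus, (∑ x ∈ s, ∑ y ∈ s, f x * f y * cos (phase (x - y) k)) *
        symbol k ^ (-α / 2) := by
    simp only [Finset.sum_mul, mul_assoc]
    rw [integral_finsetSum _ fun x _ => integrable_finsetSum _ fun y _ =>
      ((integrableOn_cos_phase_mul hα₀ hα₃ (x - y)).const_mul _).const_mul _]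
    rw [Finset.mul_sum]
    refine Finset.sum_congr rfl fun x _ => ?_
    rw [integral_finsetSum _ fun y _ =>
      ((integrableOn_cos_phase_mul hα₀ hα₃ (x - y)).const_mul _).const_mul _, Finset.mul_sum]
    refine Finset.sum_congr rfl fun y _ => ?_
    rw [integral_const_mul, integral_const_mul, green_eq hα₀ hα₃]
    ring
  -- Parseval: the off-diagonal cosines integrate to zero.
  have hL : (2 * π) ^ 3 * ∑ x ∈ s, f x ^ 2 =
      ∫ k in torus, ∑ x ∈ s, ∑ y ∈ s, f x * f y * cos (phase (x - y) k) := by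
    rw [integral_finsetSum _ fun x _ => integrable_finsetSum _ fun y _ =>
      (hcos (x - y)).const_mul _, Finset.mul_sum]
    refine Finset.sum_congr rfl fun x hx => ?_
    rw [integral_finsetSum _ fun y _ => (hcos (x - y)).const_mul _]
    simp only [integral_const_mul, integral_cos_phase, sub_eq_zero, mul_ite, mul_zero]
    rw [Finset.sum_ite_eq s x, if_pos hx]
    ring
  rw [hR, greenLower, mul_assoc, mul_assoc, hL, ← integral_const_mul]
  refine mul_le_mul_of_nonneg_left (integral_mono_ae ?_ ?_ ?_) (greenConst_pos hα₀).le
  · exact (integrable_finsetSum _ fun x _ => integrable_finsetSum _ fun y _ =>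
      (hcos (x - y)).const_mul _).const_mul _
  · simp only [Finset.sum_mul, mul_assoc]
    exact integrable_finsetSum _ fun x _ => integrable_finsetSum _ fun y _ =>
      ((integrableOn_cos_phase_mul hα₀ hα₃ (x - y)).const_mul _).const_mul _
  · filter_upwards [ae_torus_mem_Ioo] with k hk
    rw [mul_comm]
    refine mul_le_mul_of_nonneg_left ?_ (sum_mul_cos_phase_sub_nonneg s f k)
    have hpos : 0 < symbol k := by
      rw [symbol_eq_sum]
      exact Finset.sum_pos (fun j _ => two_sub_two_cos_pos (hk j)) Finset.univ_nonempty
    exact rpow_le_rpow_of_nonpos hpos (symbol_le k) (by linarith)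

/-! ### Sequence spaces on the lattice -/

/-- The space `ℓ¹(ℤ³)`. -/
abbrev L1 : Type := lp (fun _ : Z3 => ℝ) 1

/-- The space `ℓ²(ℤ³)`. -/
abbrev L2 : Type := lp (fun _ : Z3 => ℝ) 2

theorem memL1_iff {f : Z3 → ℝ} : Memℓp f 1 ↔ Summable fun x => |f x| := by
  rw [memℓp_gen_iff (by simp)]
  simp

theorem memL2_iff {f : Z3 → ℝ} : Memℓp f 2 ↔ Summable fun x => f x ^ 2 := by
  rw [memℓp_gen_iff (by simp)]
  simp

theorem L1.summable_abs (f : L1) : Summable fun x => |f x| := memL1_iff.1 f.2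

theorem L2.summable_sq (f : L2) : Summable fun x => f x ^ 2 := memL2_iff.1 f.2

theorem L1.norm_eq (f : L1) : ‖f‖ = ∑' x, |f x| := by
  simpa using lp.norm_eq_tsum_rpow (by simp) f

theorem L2.norm_sq_eq (f : L2) : ‖f‖ ^ 2 = ∑' x, f x ^ 2 := by
  simpa using lp.norm_rpow_eq_tsum (by simp) f

theorem L2.abs_apply_le (f : L2) (x : Z3) : |f x| ≤ ‖f‖ :=
  lp.norm_apply_le_norm two_ne_zero f x

theorem L1.norm_le_of_abs_le {f : L1} {g : Z3 → ℝ} {C : ℝ} (h : ∀ x, |f x| ≤ g x)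
    (hg : Summable g) (hC : ∑' x, g x ≤ C) : ‖f‖ ≤ C := by
  rw [f.norm_eq]
  exact (f.summable_abs.tsum_le_tsum h hg).trans hC

theorem L2.summable_abs_mul (f g : L2) : Summable fun x => |f x| * |g x| :=
  summable_mul_of_sq (by simpa using f.summable_sq) (by simpa using g.summable_sq)

theorem L2.tsum_abs_mul_le (f g : L2) : ∑' x, |f x| * |g x| ≤ ‖f‖ * ‖g‖ :=
  lp.tsum_mul_le_mul_norm' (by simpa using Real.HolderConjugate.two_two) f g

/-- Pointwise multiplication `ℓ² × ℓ² → ℓ¹`. -/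
def mulL : L2 →L[ℝ] L2 →L[ℝ] L1 :=
  LinearMap.mkContinuous₂
    (LinearMap.mk₂ ℝ
      (fun f g => (⟨fun x => f x * g x, memL1_iff.2 <| by
        simpa only [abs_mul] using f.summable_abs_mul g⟩ : L1))
      (fun f f' g => lp.ext <| funext fun x => add_mul _ _ _)
      (fun c f g => lp.ext <| funext fun x => mul_assoc _ _ _)
      (fun f g g' => lp.ext <| funext fun x => mul_add _ _ _)
      (fun c f g => lp.ext <| funext fun x => mul_left_comm _ _ _))
    1 fun f g => by
      rw [one_mul]
      exact L1.norm_le_of_abs_le (fun x => (abs_mul (f x) (g x)).le) (f.summable_abs_mul g)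
        (f.tsum_abs_mul_le g)

@[simp] theorem mulL_apply (f g : L2) (x : Z3) : mulL f g x = f x * g x := rfl

/-! ### The power map `ℓ² → ℓ¹` -/

theorem abs_rpow_eq_sq_mul {p : ℝ} (hp : 3 < p) (t : ℝ) : |t| ^ p = |t| ^ (p - 2) * t ^ 2 := by
  rw [← sq_abs, ← rpow_natCast, ← rpow_add_of_nonneg (abs_nonneg t) (by linarith) (by norm_num)]
  congr 1
  push_cast
  ring

theorem L2.abs_rpow_le (f : L2) {q : ℝ} (hq : 0 ≤ q) (x : Z3) : |f x| ^ q ≤ ‖f‖ ^ q :=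
  rpow_le_rpow (abs_nonneg _) (f.abs_apply_le x) hq

theorem L2.abs_rpow_le_mul_sq {p : ℝ} (hp : 3 < p) (f : L2) (x : Z3) :
    |f x| ^ p ≤ ‖f‖ ^ (p - 2) * f x ^ 2 := by
  rw [abs_rpow_eq_sq_mul hp]
  exact mul_le_mul_of_nonneg_right (f.abs_rpow_le (by linarith) x) (sq_nonneg _)

theorem L2.summable_abs_rpow {p : ℝ} (hp : 3 < p) (f : L2) : Summable fun x => |f x| ^ p :=
  Summable.of_nonneg_of_le (fun _ => by positivity) (f.abs_rpow_le_mul_sq hp)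
    (f.summable_sq.mul_left _)

/-- The power map `u ↦ |u|^p` from `ℓ²` to `ℓ¹`. -/
def absPow {p : ℝ} (hp : 3 < p) (f : L2) : L1 :=
  ⟨fun x => |f x| ^ p, memL1_iff.2 <| by
    simpa only [abs_of_nonneg (rpow_nonneg (abs_nonneg _) p)] using f.summable_abs_rpow hp⟩

@[simp] theorem absPow_apply {p : ℝ} (hp : 3 < p) (f : L2) (x : Z3) :
    absPow hp f x = |f x| ^ p := rfl

theorem norm_absPow_le {p : ℝ} (hp : 3 < p) (f : L2) :
    ‖absPow hp f‖ ≤ ‖f‖ ^ (p - 2) * ‖f‖ ^ 2 := by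
  rw [f.norm_sq_eq, ← tsum_mul_left]
  refine L1.norm_le_of_abs_le (fun x => ?_) (f.summable_sq.mul_left _) le_rfl
  rw [absPow_apply, abs_of_nonneg (by positivity)]
  exact f.abs_rpow_le_mul_sq hp x

/-- The map `u ↦ |u|^{p-2} u` from `ℓ²` to itself. -/
def signedPow {p : ℝ} (hp : 3 < p) (f : L2) : L2 :=
  ⟨fun x => |f x| ^ (p - 2) * f x, memL2_iff.2 <| by
    refine Summable.of_nonneg_of_le (fun _ => sq_nonneg _) (fun x => ?_)
      (f.summable_sq.mul_left ((‖f‖ ^ (p - 2)) ^ 2))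
    rw [mul_pow]
    have := f.abs_rpow_le (q := p - 2) (by linarith) x
    gcongr⟩

/-- The standing bound `3 < p` makes the exponent `p - 2` exceed 1, so `|t|^{p-2}` is differentiable
at the origin too. -/
theorem hasDerivAt_signedPow {p : ℝ} (hp : 3 < p) (t : ℝ) :
    HasDerivAt (fun t : ℝ => |t| ^ (p - 2) * t) ((p - 1) * |t| ^ (p - 2)) t := by
  have h := (hasDerivAt_abs_rpow t (p := p - 2) (by linarith)).mul (hasDerivAt_id t)
  convert! h using 1
  rcases eq_or_ne t 0 with rfl | ht
  · simp [zero_rpow (by linarith : p - 2 ≠ 0)]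
  · have h1 : |t| ^ (p - 2) = |t| ^ (p - 2 - 2) * t ^ 2 := by
      rw [← sq_abs, ← rpow_natCast, ← rpow_add (abs_pos.2 ht)]
      congr 1
      push_cast
      ring
    simp only [id, mul_one]
    rw [h1]
    ring

theorem abs_signedPow_sub_le {p M s t : ℝ} (hp : 3 < p) (hs : |s| ≤ M) (ht : |t| ≤ M) :
    |(|t| ^ (p - 2) * t) - |s| ^ (p - 2) * s| ≤ (p - 1) * M ^ (p - 2) * |t - s| := by
  refine Convex.norm_image_sub_le_of_norm_hasDerivWithin_le (s := Icc (-M) M)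
    (fun r _ => (hasDerivAt_signedPow hp r).hasDerivWithinAt) (fun r hr => ?_)
    (convex_Icc _ _) (abs_le.1 hs) (abs_le.1 ht)
  rw [norm_mul, norm_of_nonneg (by linarith), norm_of_nonneg (by positivity)]
  refine mul_le_mul_of_nonneg_left ?_ (by linarith)
  exact rpow_le_rpow (abs_nonneg _) (abs_le.2 hr) (by linarith)

/-- Mean value inequality for `|t|^p` minus its linearization at a third point `c`. Two free points
`a`, `b` are what strict differentiability at `c` requires. -/
theorem abs_absPow_sub_le {p M a b c : ℝ} (hp : 3 < p) (ha : |a| ≤ M) (hb : |b| ≤ M)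
    (hc : |c| ≤ M) :
    |(|a| ^ p - |b| ^ p - p * (|c| ^ (p - 2) * c) * (a - b))| ≤
      p * ((p - 1) * M ^ (p - 2)) * ((|a - c| + |b - c|) * |a - b|) := by
  have hM : 0 ≤ M := (abs_nonneg a).trans ha
  have hder : ∀ r : ℝ, HasDerivAt (fun t => |t| ^ p - p * (|c| ^ (p - 2) * c) * t)
      (p * |r| ^ (p - 2) * r - p * (|c| ^ (p - 2) * c)) r := fun r => by
    have h2 := (hasDerivAt_id r).const_mul (p * (|c| ^ (p - 2) * c))
    rw [mul_one] at h2
    exact (hasDerivAt_abs_rpow r (by linarith)).sub h2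
  have key := Convex.norm_image_sub_le_of_norm_hasDerivWithin_le (s := uIcc b a)
    (C := p * ((p - 1) * M ^ (p - 2)) * (|a - c| + |b - c|))
    (fun r _ => (hder r).hasDerivWithinAt) (fun r hr => ?_)
    (convex_uIcc _ _) left_mem_uIcc right_mem_uIcc
  · rw [norm_eq_abs, norm_eq_abs] at key
    refine le_trans (le_of_eq (congrArg abs ?_)) (key.trans_eq (mul_assoc _ _ _))
    ring
  · have hr' : |r| ≤ M := by
      have := (uIcc_subset_Icc (abs_le.1 hb) (abs_le.1 ha)) hr
      exact abs_le.2 this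
    have h1 := abs_signedPow_sub_le hp hc hr'
    have h2 : |r - c| ≤ |a - c| + |b - c| := by
      rcases mem_uIcc.1 hr with ⟨h3, h4⟩ | ⟨h3, h4⟩ <;>
      · rw [abs_le]
        constructor <;>
        linarith [le_abs_self (a - c), le_abs_self (b - c), neg_abs_le (a - c),
          neg_abs_le (b - c), abs_nonneg (a - c), abs_nonneg (b - c)]
    rw [show p * |r| ^ (p - 2) * r - p * (|c| ^ (p - 2) * c) =
      p * (|r| ^ (p - 2) * r - |c| ^ (p - 2) * c) by ring, norm_mul,
      norm_of_nonneg (by linarith : 0 ≤ p), mul_assoc]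
    refine mul_le_mul_of_nonneg_left (h1.trans ?_) (by linarith)
    exact mul_le_mul_of_nonneg_left h2 (mul_nonneg (by linarith) (by positivity))

theorem norm_absPow_sub_le {p M : ℝ} (hp : 3 < p) (f g c : L2) (hf : ‖f‖ ≤ M) (hg : ‖g‖ ≤ M)
    (hc : ‖c‖ ≤ M) :
    ‖absPow hp f - absPow hp g -
        (p • mulL (signedPow hp c)) (f - g)‖ ≤
      p * ((p - 1) * M ^ (p - 2)) * (‖f - c‖ + ‖g - c‖) * ‖f - g‖ := by
  have hM : 0 ≤ M := (norm_nonneg f).trans hf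
  have hC : 0 ≤ p * ((p - 1) * M ^ (p - 2)) :=
    mul_nonneg (by linarith) (mul_nonneg (by linarith) (by positivity))
  have hs := ((f - c).summable_abs_mul (f - g)).add ((g - c).summable_abs_mul (f - g))
  refine L1.norm_le_of_abs_le
    (g := fun x => p * ((p - 1) * M ^ (p - 2)) *
      (|(f - c) x| * |(f - g) x| + |(g - c) x| * |(f - g) x|)) (fun x => ?_) (hs.mul_left _) ?_
  · have := abs_absPow_sub_le hp ((f.abs_apply_le x).trans hf) ((g.abs_apply_le x).trans hg)
      ((c.abs_apply_le x).trans hc)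
    rw [← add_mul]
    refine le_trans (le_of_eq (congrArg abs ?_)) this
    change |f x| ^ p - |g x| ^ p - p * ((|c x| ^ (p - 2) * c x) * (f x - g x)) = _
    rw [mul_assoc p]
  · rw [tsum_mul_left, ((f - c).summable_abs_mul (f - g)).tsum_add
      ((g - c).summable_abs_mul (f - g)), mul_assoc _ (_ + _)]
    refine mul_le_mul_of_nonneg_left ?_ hC
    rw [add_mul]
    exact add_le_add (L2.tsum_abs_mul_le _ _) (L2.tsum_abs_mul_le _ _)

/-- Strictness matters in the criticality argument, which compares two points that both move towards
the minimizer. -/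
theorem hasStrictFDerivAt_absPow {p : ℝ} (hp : 3 < p) (c : L2) :
    HasStrictFDerivAt (absPow hp)
      (p • mulL (signedPow hp c)) c := by
  refine .of_isLittleO ?_
  rw [Asymptotics.isLittleO_iff]
  intro ε hε
  have hball : ∀ᶠ q : L2 × L2 in 𝓝 (c, c), ‖q.1‖ < ‖c‖ + 1 ∧ ‖q.2‖ < ‖c‖ + 1 := by
    have h1 : IsOpen {q : L2 × L2 | ‖q.1‖ < ‖c‖ + 1} := isOpen_lt (by fun_prop) (by fun_prop)
    have h2 : IsOpen {q : L2 × L2 | ‖q.2‖ < ‖c‖ + 1} := isOpen_lt (by fun_prop) (by fun_prop)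
    exact (h1.inter h2).mem_nhds ⟨by simp, by simp⟩
  have hcont : Continuous fun q : L2 × L2 =>
      p * ((p - 1) * (‖c‖ + 1) ^ (p - 2)) * (‖q.1 - c‖ + ‖q.2 - c‖) := by fun_prop
  have hsmall : ∀ᶠ q : L2 × L2 in 𝓝 (c, c),
      p * ((p - 1) * (‖c‖ + 1) ^ (p - 2)) * (‖q.1 - c‖ + ‖q.2 - c‖) < ε :=
    (isOpen_lt hcont continuous_const).mem_nhds (by simpa using hε)
  filter_upwards [hball, hsmall] with q hq1 hq2
  exact (norm_absPow_sub_le hp q.1 q.2 c hq1.1.le hq1.2.le (by linarith)).trans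
    (mul_le_mul_of_nonneg_right hq2.le (norm_nonneg _))

/-! ### The Green's form on `ℓ¹` -/

variable {α : ℝ}

theorem summable_green_mul (hα₀ : 0 < α) (hα₃ : α < 3) (f : L1) (x : Z3) :
    Summable fun y => green α x y * f y := by
  refine Summable.of_norm_bounded (f.summable_abs.mul_left (greenBound α)) fun y => ?_
  rw [norm_mul]
  exact mul_le_mul_of_nonneg_right (abs_green_le hα₀ hα₃ x y) (abs_nonneg _)

theorem abs_greenConv_le (hα₀ : 0 < α) (hα₃ : α < 3) (f : L1) (x : Z3) :
    |greenConv α f x| ≤ greenBound α * ‖f‖ := by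
  rw [f.norm_eq, ← tsum_mul_left, ← norm_eq_abs]
  refine tsum_of_norm_bounded (f.summable_abs.mul_left _).hasSum fun y => ?_
  rw [norm_mul]
  exact mul_le_mul_of_nonneg_right (abs_green_le hα₀ hα₃ x y) (abs_nonneg _)

theorem norm_greenConv_mul_le (hα₀ : 0 < α) (hα₃ : α < 3) (f g : L1) (x : Z3) :
    ‖greenConv α f x * g x‖ ≤ greenBound α * ‖f‖ * |g x| := by
  rw [norm_mul]
  exact mul_le_mul_of_nonneg_right (abs_greenConv_le hα₀ hα₃ f x) (abs_nonneg _)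

theorem summable_greenConv_mul (hα₀ : 0 < α) (hα₃ : α < 3) (f g : L1) :
    Summable fun x => greenConv α f x * g x :=
  Summable.of_norm_bounded (g.summable_abs.mul_left _) (norm_greenConv_mul_le hα₀ hα₃ f g)

theorem greenConv_add (hα₀ : 0 < α) (hα₃ : α < 3) (f g : L1) (x : Z3) :
    greenConv α (f + g : L1) x = greenConv α f x + greenConv α g x := by
  unfold greenConv
  rw [← (summable_green_mul hα₀ hα₃ f x).tsum_add (summable_green_mul hα₀ hα₃ g x)]
  exact tsum_congr fun y => mul_add _ _ _

theorem greenConv_smul (c : ℝ) (f : L1) (x : Z3) :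
    greenConv α (c • f : L1) x = c * greenConv α f x := by
  unfold greenConv
  rw [← tsum_mul_left]
  exact tsum_congr fun y => mul_left_comm _ _ _

/-- The Green's form `(f, g) ↦ ∫ (R_α ∗ f) g dμ` on `ℓ¹`. -/
def greenForm (hα₀ : 0 < α) (hα₃ : α < 3) : L1 →L[ℝ] L1 →L[ℝ] ℝ :=
  LinearMap.mkContinuous₂
    (LinearMap.mk₂ ℝ (fun f g : L1 => ∑' x, greenConv α f x * g x)
      (fun f f' g => by
        simp only [greenConv_add hα₀ hα₃, add_mul]
        exact (summable_greenConv_mul hα₀ hα₃ f g).tsum_add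
          (summable_greenConv_mul hα₀ hα₃ f' g))
      (fun c f g => by
        simp only [greenConv_smul, mul_assoc, tsum_mul_left, smul_eq_mul])
      (fun f g g' => by
        rw [← (summable_greenConv_mul hα₀ hα₃ f g).tsum_add
          (summable_greenConv_mul hα₀ hα₃ f g')]
        exact tsum_congr fun x => mul_add _ _ _)
      (fun c f g => by
        rw [smul_eq_mul, ← tsum_mul_left]
        exact tsum_congr fun x => mul_left_comm _ _ _))
    (greenBound α) fun f g => by
      rw [g.norm_eq, ← tsum_mul_left]
      exact tsum_of_norm_bounded (g.summable_abs.mul_left _).hasSum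
        (norm_greenConv_mul_le hα₀ hα₃ f g)

theorem greenForm_apply (hα₀ : 0 < α) (hα₃ : α < 3) (f g : L1) :
    greenForm hα₀ hα₃ f g = ∑' x, greenConv α f x * g x := rfl

theorem greenForm_single (hα₀ : 0 < α) (hα₃ : α < 3) (x y : Z3) (s t : ℝ) :
    greenForm hα₀ hα₃ (lp.single 1 x s) (lp.single 1 y t) = s * t * green α x y := by
  rw [greenForm_apply, tsum_eq_single y fun z hz => by
    rw [lp.single_apply_ne _ _ _ hz, mul_zero], lp.single_apply_self]
  unfold greenConv
  rw [tsum_eq_single x fun z hz => by rw [lp.single_apply_ne _ _ _ hz, mul_zero],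
    lp.single_apply_self, green_comm hα₀ hα₃]
  ring

/-- A bounded bilinear form on `ℓ¹` is determined by its values on point masses, where symmetry is
`green_comm`; no exchange of infinite sums is needed. -/
theorem greenForm_comm (hα₀ : 0 < α) (hα₃ : α < 3) (f g : L1) :
    greenForm hα₀ hα₃ f g = greenForm hα₀ hα₃ g f := by
  have h : greenForm hα₀ hα₃ = (greenForm hα₀ hα₃).flip := by
    refine lp.ext_continuousLinearMap ENNReal.one_ne_top fun x => ?_
    ext : 1
    refine lp.ext_continuousLinearMap ENNReal.one_ne_top fun y => ?_
    ext
    simp only [ContinuousLinearMap.comp_apply, lp.singleContinuousLinearMap_apply,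
      ContinuousLinearMap.flip_apply, greenForm_single]
    rw [green_comm hα₀ hα₃]
  conv_lhs => rw [h]
  rfl

/-- The finite inequality passes to the limit because truncations converge in `ℓ¹` and the form is
continuous there. A finite `t` suffices: the empty set gives semidefiniteness, a singleton gives
growth along fibres. -/
theorem greenLower_mul_sum_sq_le_greenForm (hα₀ : 0 < α) (hα₃ : α < 3) (f : L1)
    (t : Finset Z3) : greenLower α * ∑ x ∈ t, f x ^ 2 ≤ greenForm hα₀ hα₃ f f := by
  have hf : Tendsto (fun s : Finset Z3 => ∑ x ∈ s, lp.single 1 x (f x)) atTop (𝓝 f) :=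
    lp.hasSum_single ENNReal.one_ne_top f
  have hB : Tendsto (fun s : Finset Z3 => greenForm hα₀ hα₃ (∑ x ∈ s, lp.single 1 x (f x))
      (∑ x ∈ s, lp.single 1 x (f x))) atTop (𝓝 (greenForm hα₀ hα₃ f f)) := by
    have hc : Continuous fun g : L1 => greenForm hα₀ hα₃ g g := by fun_prop
    exact (hc.tendsto f).comp hf
  refine ge_of_tendsto hB ((eventually_ge_atTop t).mono fun s hs => ?_)
  simp only [map_sum, sum_apply, greenForm_single]
  calc greenLower α * ∑ x ∈ t, f x ^ 2 ≤ greenLower α * ∑ x ∈ s, f x ^ 2 :=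
        mul_le_mul_of_nonneg_left
          (Finset.sum_le_sum_of_subset_of_nonneg hs fun _ _ _ => sq_nonneg _) (greenLower_pos hα₀).le
    _ ≤ ∑ x ∈ s, ∑ y ∈ s, f x * f y * green α x y := greenLower_mul_sum_sq_le hα₀ hα₃ s f
    _ = ∑ y ∈ s, ∑ x ∈ s, f x * f y * green α x y := Finset.sum_comm
    _ = _ := Finset.sum_congr rfl fun x _ => Finset.sum_congr rfl fun y _ => rfl

theorem greenForm_self_nonneg (hα₀ : 0 < α) (hα₃ : α < 3) (f : L1) :
    0 ≤ greenForm hα₀ hα₃ f f := by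
  simpa using greenLower_mul_sum_sq_le_greenForm hα₀ hα₃ f ∅

/-! ### The Dirichlet form on `ℓ²` -/

/-- Translation by `d` on `ℓ²`. -/
def shiftL (d : Z3) : L2 →L[ℝ] L2 :=
  LinearMap.mkContinuous
    { toFun := fun f => ⟨fun x => f (x + d), memL2_iff.2
        ((Equiv.addRight d).summable_iff.2 f.summable_sq)⟩
      map_add' := fun f g => rfl
      map_smul' := fun c f => rfl } 1 fun f => by
    rw [one_mul]
    refine abs_le_of_sq_le_sq' ?_ (norm_nonneg _) |>.2
    rw [L2.norm_sq_eq, L2.norm_sq_eq]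
    exact ((Equiv.addRight d).tsum_eq fun x => f x ^ 2).le

/-- The difference operator `f ↦ f(· + d) - f`. -/
def diffL (d : Z3) : L2 →L[ℝ] L2 := shiftL d - ContinuousLinearMap.id ℝ L2

/-- The Dirichlet form `(f, g) ↦ ∫ ∇f ∇g dμ` on `ℓ²`. -/
def dirichletForm : L2 →L[ℝ] L2 →L[ℝ] ℝ :=
  (1 / 2 : ℝ) • ∑ d ∈ lattice.neighborFinset 0, (innerSL ℝ).bilinearComp (diffL d) (diffL d)

theorem gradForm_eq (u v : Z3 → ℝ) (x : Z3) :
    gradForm u v x = 1 / 2 * ∑ d ∈ lattice.neighborFinset 0,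
      (u (x + d) - u x) * (v (x + d) - v x) := by
  rw [gradForm, neighborFinset_eq, Finset.sum_map]
  rfl

theorem dirichletForm_apply (f g : L2) : dirichletForm f g = ∑' x, gradForm f g x := by
  have h1 : dirichletForm f g =
      1 / 2 * ∑ d ∈ lattice.neighborFinset 0, ∑' x, diffL d f x * diffL d g x := by
    simp only [dirichletForm, smul_apply, sum_apply,
      ContinuousLinearMap.bilinearComp_apply, innerSL_apply_apply, lp.inner_eq_tsum, smul_eq_mul]
    congr 1
    exact Finset.sum_congr rfl fun d _ => tsum_congr fun x => mul_comm _ _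
  rw [h1, ← Summable.tsum_finsetSum fun d _ =>
    summable_mul_of_sq (diffL d f).summable_sq (diffL d g).summable_sq, ← tsum_mul_left]
  exact tsum_congr fun x => (gradForm_eq _ _ _).symm

theorem dirichletForm_comm (f g : L2) : dirichletForm f g = dirichletForm g f := by
  simp only [dirichletForm_apply]
  exact tsum_congr fun x => gradForm_comm _ _ _

theorem dirichletForm_self_nonneg (f : L2) : 0 ≤ dirichletForm f f := by
  rw [dirichletForm_apply]
  exact tsum_nonneg (gradForm_self_nonneg f)

/-! ### The energy functional -/

theorem hasStrictFDerivAt_bilin_diag {E F : Type*} [NormedAddCommGroup E] [NormedSpace ℝ E]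
    [NormedAddCommGroup F] [NormedSpace ℝ F] (B : F →L[ℝ] F →L[ℝ] ℝ)
    (hB : ∀ f g, B f g = B g f) {N : E → F} {N' : E →L[ℝ] F} {w : E}
    (hN : HasStrictFDerivAt N N' w) :
    HasStrictFDerivAt (fun w => B (N w) (N w)) ((2 : ℝ) • (B (N w)).comp N') w := by
  refine (B.hasStrictFDerivAt_of_bilinear hN hN).congr_fderiv ?_
  ext v
  change B (N w) (N' v) + B (N' v) (N w) = 2 * B (N w) (N' v)
  rw [hB (N' v), two_mul]

section LowerTerm

variable {α p : ℝ}

/-- The part `w ↦ (b/4) (∫ |∇w|²)² - (1/(2p)) ∫ (R_α ∗ |w|^p) |w|^p` of the energy, on `ℓ²`. -/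
def lowerTerm (b : ℝ) (hα₀ : 0 < α) (hα₃ : α < 3) (hp : 3 < p) (w : L2) : ℝ :=
  b / 4 * dirichletForm w w ^ 2 -
    1 / (2 * p) * greenForm hα₀ hα₃ (absPow hp w) (absPow hp w)

/-- The derivative of `lowerTerm`. -/
def lowerTermDeriv (b : ℝ) (hα₀ : 0 < α) (hα₃ : α < 3) (hp : 3 < p) (w : L2) : L2 →L[ℝ] ℝ :=
  (b * dirichletForm w w) • dirichletForm w -
    (greenForm hα₀ hα₃ (absPow hp w)).comp (mulL (signedPow hp w))

theorem hasStrictFDerivAt_lowerTerm (b : ℝ) (hα₀ : 0 < α) (hα₃ : α < 3) (hp : 3 < p) (w : L2) :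
    HasStrictFDerivAt (lowerTerm b hα₀ hα₃ hp) (lowerTermDeriv b hα₀ hα₃ hp w) w := by
  have h1 : HasStrictFDerivAt (fun w => dirichletForm w w)
      ((2 : ℝ) • (dirichletForm w).comp (ContinuousLinearMap.id ℝ L2)) w :=
    hasStrictFDerivAt_bilin_diag dirichletForm dirichletForm_comm (hasStrictFDerivAt_id w)
  have h2 := hasStrictFDerivAt_bilin_diag (greenForm hα₀ hα₃) (greenForm_comm hα₀ hα₃)
    (hasStrictFDerivAt_absPow hp w)
  convert! ((h1.pow 2).const_mul (b / 4)).sub (h2.const_mul (1 / (2 * p))) using 1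
  ext v
  have hp0 : p ≠ 0 := by linarith
  simp only [lowerTermDeriv, sub_apply, smul_apply, ContinuousLinearMap.comp_apply,
    smul_eq_mul, map_smul, ContinuousLinearMap.id_apply]
  field_simp
  push_cast
  ring

theorem continuous_lowerTerm (b : ℝ) (hα₀ : 0 < α) (hα₃ : α < 3) (hp : 3 < p) :
    Continuous (lowerTerm b hα₀ hα₃ hp) :=
  continuous_iff_continuousAt.2 fun w => (hasStrictFDerivAt_lowerTerm b hα₀ hα₃ hp w).continuousAt

end LowerTerm

/-! ### The energy as half the squared norm of `H` plus a differentiable term on `ℓ²`. -/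

section HSpace

variable {a b α p : ℝ} {h : Z3 → ℝ} {ha : 0 < a} {hh : UniformlyPositive h}

theorem inner_eq_innerH (u v : HSpace ha hh) : inner ℝ u v = innerH u v := rfl

theorem HSpace.summable_weighted (u : HSpace ha hh) : Summable fun x => h x * u x ^ 2 := u.2.2

theorem HSpace.ext {u v : HSpace ha hh} (huv : ∀ x, u x = v x) : u = v :=
  Subtype.ext (funext huv)

theorem HSpace.norm_sq_eq_tsum (u : HSpace ha hh) :
    ‖u‖ ^ 2 = ∑' x, (a * gradForm u u x + h x * u x ^ 2) := by
  rw [← real_inner_self_eq_norm_sq, inner_eq_innerH, innerH]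
  exact tsum_congr fun x => by ring

theorem HSpace.summable_norm_sq (u : HSpace ha hh) :
    Summable fun x => a * gradForm u u x + h x * u x ^ 2 :=
  ((summable_gradForm_self u.summable_sq).mul_left a).add u.summable_weighted

theorem HSpace.tsum_weighted_le (u : HSpace ha hh) : ∑' x, h x * u x ^ 2 ≤ ‖u‖ ^ 2 := by
  rw [u.norm_sq_eq_tsum]
  exact u.summable_weighted.tsum_le_tsum
    (fun x => le_add_of_nonneg_left (mul_nonneg ha.le (gradForm_self_nonneg u x)))
    u.summable_norm_sq

/-- A positive lower bound of the potential. -/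
def lowerBound (hh : UniformlyPositive h) : ℝ := hh.choose

theorem lowerBound_pos (hh : UniformlyPositive h) : 0 < lowerBound hh := hh.choose_spec.1

theorem lowerBound_le (hh : UniformlyPositive h) (x : Z3) : lowerBound hh ≤ h x :=
  hh.choose_spec.2 x

theorem HSpace.lowerBound_mul_tsum_sq_le (u : HSpace ha hh) :
    lowerBound hh * ∑' x, u x ^ 2 ≤ ∑' x, h x * u x ^ 2 := by
  rw [← tsum_mul_left]
  exact (u.summable_sq.mul_left _).tsum_le_tsum
    (fun x => mul_le_mul_of_nonneg_right (lowerBound_le hh x) (sq_nonneg _)) u.summable_weighted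

/-- The embedding `H → ℓ²`. -/
def toL2 : HSpace ha hh →L[ℝ] L2 :=
  LinearMap.mkContinuous
    { toFun := fun u => ⟨fun x => u x, memL2_iff.2 u.summable_sq⟩
      map_add' := fun u v => rfl
      map_smul' := fun c u => rfl } (√(lowerBound hh))⁻¹ fun u => by
    have hpos := lowerBound_pos hh
    refine abs_le_of_sq_le_sq' ?_ (by positivity) |>.2
    rw [mul_pow, inv_pow, sq_sqrt hpos.le, inv_mul_eq_div, le_div_iff₀' hpos, L2.norm_sq_eq]
    exact u.lowerBound_mul_tsum_sq_le.trans u.tsum_weighted_le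

theorem coe_toL2 (u : HSpace ha hh) : (toL2 u : Z3 → ℝ) = u := rfl

@[simp] theorem toL2_apply (u : HSpace ha hh) (x : Z3) : toL2 u x = u x := rfl

theorem HSpace.lowerBound_mul_norm_toL2_sq_le (u : HSpace ha hh) :
    lowerBound hh * ‖toL2 u‖ ^ 2 ≤ ∑' x, h x * u x ^ 2 := by
  rw [L2.norm_sq_eq]
  exact u.lowerBound_mul_tsum_sq_le

theorem dirichletEnergy_eq (u : HSpace ha hh) :
    dirichletEnergy u = dirichletForm (toL2 u) (toL2 u) := by
  rw [dirichletForm_apply, coe_toL2, dirichletEnergy]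

theorem HSpace.inner_eq (u v : HSpace ha hh) :
    inner ℝ u v = a * dirichletForm (toL2 u) (toL2 v) + ∑' x, h x * u x * v x := by
  rw [dirichletForm_apply, inner_eq_innerH, innerH, ← tsum_mul_left]
  exact ((summable_gradForm u.summable_sq v.summable_sq).mul_left a).tsum_add
    (summable_weighted_mul hh u.2.2 v.2.2)

theorem HSpace.norm_sq_eq (u : HSpace ha hh) :
    ‖u‖ ^ 2 = a * dirichletForm (toL2 u) (toL2 u) + ∑' x, h x * u x ^ 2 := by
  rw [← real_inner_self_eq_norm_sq, HSpace.inner_eq]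
  congr 1
  exact tsum_congr fun x => by ring

/-- This isolates the norm as the only part of `J` that is not continuous for `ℓ²` convergence;
lower semicontinuity is needed for it alone. -/
theorem energy_eq (hα₀ : 0 < α) (hα₃ : α < 3) (hp : 3 < p) (u : HSpace ha hh) :
    energy b α p u = 1 / 2 * ‖u‖ ^ 2 + lowerTerm b hα₀ hα₃ hp (toL2 u) := by
  rw [energy, lowerTerm, u.norm_sq_eq_tsum, dirichletEnergy_eq, greenForm_apply, ← add_sub_assoc]
  rfl

/-- The derivative of the energy. -/
def energyDeriv (b : ℝ) (hα₀ : 0 < α) (hα₃ : α < 3) (hp : 3 < p) (u : HSpace ha hh) :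
    HSpace ha hh →L[ℝ] ℝ :=
  innerSL ℝ u + (lowerTermDeriv b hα₀ hα₃ hp (toL2 u)).comp toL2

theorem hasStrictFDerivAt_energy (hα₀ : 0 < α) (hα₃ : α < 3) (hp : 3 < p) (u : HSpace ha hh) :
    HasStrictFDerivAt (energy b α p) (energyDeriv b hα₀ hα₃ hp u) u := by
  have h1 : (energy b α p : HSpace ha hh → ℝ) =
      fun u => 1 / 2 * ‖u‖ ^ 2 + lowerTerm b hα₀ hα₃ hp (toL2 u) :=
    funext (energy_eq hα₀ hα₃ hp)
  rw [h1]
  have h2 := ((hasStrictFDerivAt_norm_sq u).const_mul (1 / 2)).add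
    ((hasStrictFDerivAt_lowerTerm b hα₀ hα₃ hp (toL2 u)).comp u toL2.hasStrictFDerivAt)
  convert! h2 using 1
  rw [energyDeriv, ← Nat.cast_smul_eq_nsmul ℝ, smul_smul]
  norm_num

theorem fderiv_energy (hα₀ : 0 < α) (hα₃ : α < 3) (hp : 3 < p) (u : HSpace ha hh) :
    fderiv ℝ (energy b α p) u = energyDeriv b hα₀ hα₃ hp u :=
  (hasStrictFDerivAt_energy hα₀ hα₃ hp u).hasFDerivAt.fderiv

theorem differentiable_energy (hα₀ : 0 < α) (hα₃ : α < 3) (hp : 3 < p) :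
    Differentiable ℝ (energy b α p : HSpace ha hh → ℝ) := fun u =>
  (hasStrictFDerivAt_energy hα₀ hα₃ hp u).hasFDerivAt.differentiableAt

theorem energyDeriv_apply (hα₀ : 0 < α) (hα₃ : α < 3) (hp : 3 < p) (u v : HSpace ha hh) :
    energyDeriv b hα₀ hα₃ hp u v = inner ℝ u v +
      b * dirichletForm (toL2 u) (toL2 u) * dirichletForm (toL2 u) (toL2 v) -
      greenForm hα₀ hα₃ (absPow hp (toL2 u)) (mulL (signedPow hp (toL2 u)) (toL2 v)) := by
  rw [add_sub_assoc]
  rfl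

/-! ### The Euler–Lagrange equation -/

/-- The indicator function of a point, as an element of `H`. -/
def pointMass (ha : 0 < a) (hh : UniformlyPositive h) (x : Z3) : HSpace ha hh :=
  ⟨Pi.single x 1, memH1_iff.2 (summable_of_hasFiniteSupport ((finite_singleton x).subset
      fun y hy => by
        by_contra hne
        exact hy (by simp [Pi.single_eq_of_ne hne]))),
    summable_of_hasFiniteSupport ((finite_singleton x).subset fun y hy => by
      by_contra hne
      exact hy (by simp [Pi.single_eq_of_ne hne]))⟩

theorem pointMass_apply (x y : Z3) : pointMass ha hh x y = if y = x then 1 else 0 :=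
  Pi.single_apply x 1 y

theorem neg_mem_neighborFinset_zero {d : Z3} :
    -d ∈ lattice.neighborFinset 0 ↔ d ∈ lattice.neighborFinset 0 := by
  rw [SimpleGraph.mem_neighborFinset, SimpleGraph.mem_neighborFinset]
  change ∑ i, |(0 : Z3) i - (-d) i| = 1 ↔ ∑ i, |(0 : Z3) i - d i| = 1
  simp

/-- Summation by parts. A direction `d` contributes the differences at `x` towards `x + d` and `x -
d`; as the neighbours of the origin are symmetric under negation, the two sums agree and absorb the
factor `1 / 2`. -/
theorem dirichletForm_pointMass (f : L2) (x : Z3) :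
    dirichletForm f (toL2 (pointMass ha hh x)) = -laplacian f x := by
  have h1 : ∀ d : Z3, HasSum (fun y => (f (y + d) - f y) *
      (pointMass ha hh x (y + d) - pointMass ha hh x y)) (-(f (x + d) - f x) - (f (x + -d) - f x))
      := by
    intro d
    have e1 : HasSum (fun y => (f (y + d) - f y) * pointMass ha hh x (y + d))
        (f x - f (x + -d)) := by
      have := hasSum_single (f := fun y => (f (y + d) - f y) * pointMass ha hh x (y + d))
        (x + -d) fun y hy => by
          rw [pointMass_apply, if_neg, mul_zero]
          rintro rfl
          simp at hy
      simpa only [neg_add_cancel_right, pointMass_apply, if_true, mul_one] using this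
    have e2 : HasSum (fun y => (f (y + d) - f y) * pointMass ha hh x y) (f (x + d) - f x) := by
      have := hasSum_single (f := fun y => (f (y + d) - f y) * pointMass ha hh x y)
        x fun y hy => by rw [pointMass_apply, if_neg hy, mul_zero]
      simpa only [pointMass_apply, if_true, mul_one] using this
    convert! e1.sub e2 using 1
    · funext y
      ring
    · ring
  have h2 : HasSum (gradForm f (pointMass ha hh x))
      (1 / 2 * ∑ d ∈ lattice.neighborFinset 0, (-(f (x + d) - f x) - (f (x + -d) - f x))) := by
    convert! (hasSum_sum fun d _ => h1 d).mul_left (1 / 2) using 1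
    exact funext fun y => gradForm_eq _ _ _
  have h3 : ∑ d ∈ lattice.neighborFinset 0, (f (x + -d) - f x) =
      ∑ d ∈ lattice.neighborFinset 0, (f (x + d) - f x) :=
    Finset.sum_equiv (Equiv.neg Z3) (fun d => neg_mem_neighborFinset_zero.symm) fun d _ => rfl
  have h4 : laplacian f x = ∑ d ∈ lattice.neighborFinset 0, (f (x + d) - f x) := by
    rw [laplacian, neighborFinset_eq, Finset.sum_map]
    rfl
  rw [dirichletForm_apply]
  refine h2.tsum_eq.trans ?_
  rw [Finset.sum_sub_distrib, Finset.sum_neg_distrib, h3, h4]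
  ring

theorem solvesEquation_of_fderiv_eq_zero (hα₀ : 0 < α) (hα₃ : α < 3) (hp : 3 < p)
    {u : HSpace ha hh} (hu : fderiv ℝ (energy b α p) u = 0) : SolvesEquation a b α p h u := by
  intro x
  have h1 : energyDeriv b hα₀ hα₃ hp u (pointMass ha hh x) = 0 := by
    rw [← fderiv_energy hα₀ hα₃ hp, hu]
    rfl
  have h2 : ∑' y, h y * u y * pointMass ha hh x y = h x * u x := by
    rw [tsum_eq_single x fun y hy => by rw [pointMass_apply, if_neg hy, mul_zero],
      pointMass_apply, if_pos rfl, mul_one]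
  have h3 : greenForm hα₀ hα₃ (absPow hp (toL2 u))
      (mulL (signedPow hp (toL2 u)) (toL2 (pointMass ha hh x))) =
      greenConv α (fun y => |u y| ^ p) x * |u x| ^ (p - 2) * u x := by
    rw [greenForm_apply, tsum_eq_single x fun y hy => by
      rw [mulL_apply, toL2_apply, pointMass_apply, if_neg hy, mul_zero, mul_zero], mulL_apply,
      toL2_apply, pointMass_apply, if_pos rfl, mul_one, mul_assoc]
    rfl
  rw [energyDeriv_apply, HSpace.inner_eq, h2, h3, dirichletForm_pointMass, coe_toL2] at h1
  rw [dirichletEnergy_eq]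
  linarith

end HSpace

/-! ### Positive and negative parts -/

section Parts

variable {a b α p : ℝ} {h : Z3 → ℝ} {ha : 0 < a} {hh : UniformlyPositive h}

@[simp] theorem HSpace.pos_apply (u : HSpace ha hh) (x : Z3) : u.pos x = max (u x) 0 := rfl

@[simp] theorem HSpace.neg_apply (u : HSpace ha hh) (x : Z3) : u.neg x = min (u x) 0 := rfl

@[simp] theorem HSpace.sub_apply (u v : HSpace ha hh) (x : Z3) : (u - v) x = u x - v x := rfl

@[simp] theorem HSpace.smul_apply (c : ℝ) (u : HSpace ha hh) (x : Z3) : (c • u) x = c * u x := rfl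

/-- The combination `s u⁺ + t u⁻`. -/
def comb (s t : ℝ) (u : HSpace ha hh) : HSpace ha hh := s • u.pos + t • u.neg

theorem comb_apply (s t : ℝ) (u : HSpace ha hh) (x : Z3) :
    comb s t u x = s * max (u x) 0 + t * min (u x) 0 := rfl

theorem HSpace.pos_add_neg (u : HSpace ha hh) : u.pos + u.neg = u :=
  HSpace.ext fun x => max_add_min (u x) 0 |>.trans (add_zero _)

theorem comb_one_one (u : HSpace ha hh) : comb 1 1 u = u := by
  rw [comb, one_smul, one_smul, u.pos_add_neg]

theorem comb_pos {s t : ℝ} (hs : 0 ≤ s) (ht : 0 ≤ t) (u : HSpace ha hh) :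
    (comb s t u).pos = s • u.pos := by
  refine HSpace.ext fun x => ?_
  rw [HSpace.pos_apply, comb_apply, HSpace.smul_apply, HSpace.pos_apply]
  rcases le_total (u x) 0 with hx | hx
  · simp [hx, mul_nonpos_of_nonneg_of_nonpos ht hx]
  · simp [hx, mul_nonneg hs hx]

theorem comb_neg {s t : ℝ} (hs : 0 ≤ s) (ht : 0 ≤ t) (u : HSpace ha hh) :
    (comb s t u).neg = t • u.neg := by
  refine HSpace.ext fun x => ?_
  rw [HSpace.neg_apply, comb_apply, HSpace.smul_apply, HSpace.neg_apply]
  rcases le_total (u x) 0 with hx | hx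
  · simp [hx, mul_nonpos_of_nonneg_of_nonpos ht hx]
  · simp [hx, mul_nonneg hs hx]

/-- The two parts have disjoint supports, so at each point only one summand survives. -/
theorem absPow_comb (hp : 3 < p) {s t : ℝ} (hs : 0 ≤ s) (ht : 0 ≤ t) (u : HSpace ha hh) :
    absPow hp (toL2 (comb s t u)) =
      s ^ p • absPow hp (toL2 u.pos) + t ^ p • absPow hp (toL2 u.neg) := by
  refine lp.ext (funext fun x => ?_)
  have h0 : (0 : ℝ) ^ p = 0 := zero_rpow (by linarith)
  change |s * max (u x) 0 + t * min (u x) 0| ^ p =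
    s ^ p * |max (u x) 0| ^ p + t ^ p * |min (u x) 0| ^ p
  rcases le_total (u x) 0 with hx | hx
  · simp [hx, h0, abs_mul, abs_of_nonneg ht, mul_rpow ht (abs_nonneg _)]
  · simp [hx, h0, abs_mul, abs_of_nonneg hs, mul_rpow hs (abs_nonneg _)]

theorem absPow_eq_add (hp : 3 < p) (u : HSpace ha hh) :
    absPow hp (toL2 u) = absPow hp (toL2 u.pos) + absPow hp (toL2 u.neg) := by
  simpa [comb_one_one] using absPow_comb hp zero_le_one zero_le_one u

theorem abs_rpow_sub_two_mul_self_mul_max (hp : 3 < p) (r : ℝ) :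
    |r| ^ (p - 2) * r * max r 0 = |max r 0| ^ p := by
  rcases le_total r 0 with hr | hr
  · simp [hr, zero_rpow (by linarith : p ≠ 0)]
  · rw [max_eq_left hr, abs_rpow_eq_sq_mul hp]
    ring

theorem abs_rpow_sub_two_mul_self_mul_min (hp : 3 < p) (r : ℝ) :
    |r| ^ (p - 2) * r * min r 0 = |min r 0| ^ p := by
  rcases le_total r 0 with hr | hr
  · rw [min_eq_left hr, abs_rpow_eq_sq_mul hp]
    ring
  · simp [hr, zero_rpow (by linarith : p ≠ 0)]

theorem mulL_signedPow_pos (hp : 3 < p) (u : HSpace ha hh) :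
    mulL (signedPow hp (toL2 u)) (toL2 u.pos) = absPow hp (toL2 u.pos) :=
  lp.ext (funext fun _ => abs_rpow_sub_two_mul_self_mul_max hp _)

theorem mulL_signedPow_neg (hp : 3 < p) (u : HSpace ha hh) :
    mulL (signedPow hp (toL2 u)) (toL2 u.neg) = absPow hp (toL2 u.neg) :=
  lp.ext (funext fun _ => abs_rpow_sub_two_mul_self_mul_min hp _)

theorem inner_pos_neg (u : HSpace ha hh) :
    inner ℝ u.pos u.neg = a * dirichletForm (toL2 u.pos) (toL2 u.neg) := by
  rw [HSpace.inner_eq]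
  have : ∀ x, h x * u.pos x * u.neg x = 0 := fun x => by
    rw [HSpace.pos_apply, HSpace.neg_apply]
    rcases le_total (u x) 0 with hx | hx <;> simp [hx]
  simp only [this, tsum_zero, add_zero]

/-- Both `max · 0` and `min · 0` are monotone, so their increments along an edge have the same sign.
Edges across a sign change may contribute strictly, so `u⁺` and `u⁻` are not orthogonal in general.
-/
theorem dirichletForm_pos_neg_nonneg (u : HSpace ha hh) :
    0 ≤ dirichletForm (toL2 u.pos) (toL2 u.neg) := by
  rw [dirichletForm_apply]
  refine tsum_nonneg fun x => mul_nonneg (by norm_num) (Finset.sum_nonneg fun y _ => ?_)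
  change 0 ≤ (max (u y) 0 - max (u x) 0) * (min (u y) 0 - min (u x) 0)
  rcases le_total (u x) (u y) with hxy | hxy
  · exact mul_nonneg (sub_nonneg.2 (max_le_max_right 0 hxy))
      (sub_nonneg.2 (min_le_min_right 0 hxy))
  · exact mul_nonneg_of_nonpos_of_nonpos (sub_nonpos.2 (max_le_max_right 0 hxy))
      (sub_nonpos.2 (min_le_min_right 0 hxy))

theorem norm_comb_sq (s t : ℝ) (u : HSpace ha hh) :
    ‖comb s t u‖ ^ 2 = s ^ 2 * ‖u.pos‖ ^ 2 +
      2 * s * t * (a * dirichletForm (toL2 u.pos) (toL2 u.neg)) + t ^ 2 * ‖u.neg‖ ^ 2 := by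
  rw [comb, norm_add_sq_real, norm_smul, norm_smul, real_inner_smul_left, real_inner_smul_right,
    inner_pos_neg, mul_pow, mul_pow, norm_eq_abs, norm_eq_abs, sq_abs, sq_abs]
  ring

theorem dirichletForm_comb (s t : ℝ) (u : HSpace ha hh) :
    dirichletForm (toL2 (comb s t u)) (toL2 (comb s t u)) =
      s ^ 2 * dirichletForm (toL2 u.pos) (toL2 u.pos) +
      2 * s * t * dirichletForm (toL2 u.pos) (toL2 u.neg) +
      t ^ 2 * dirichletForm (toL2 u.neg) (toL2 u.neg) := by
  simp only [comb, map_add, map_smul, _root_.add_apply, _root_.smul_apply, smul_eq_mul]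
  rw [dirichletForm_comm (toL2 u.neg) (toL2 u.pos)]
  ring

theorem greenForm_comb (hα₀ : 0 < α) (hα₃ : α < 3) (S T : ℝ) (f g : L1) :
    greenForm hα₀ hα₃ (S • f + T • g) (S • f + T • g) = S ^ 2 * greenForm hα₀ hα₃ f f +
      2 * S * T * greenForm hα₀ hα₃ f g + T ^ 2 * greenForm hα₀ hα₃ g g := by
  simp only [map_add, map_smul, _root_.add_apply, _root_.smul_apply, smul_eq_mul]
  rw [greenForm_comm hα₀ hα₃ g f]
  ring

theorem energy_comb (hα₀ : 0 < α) (hα₃ : α < 3) (hp : 3 < p) {s t : ℝ} (hs : 0 ≤ s) (ht : 0 ≤ t)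
    (u : HSpace ha hh) :
    energy b α p (comb s t u) =
      1 / 2 * (s ^ 2 * ‖u.pos‖ ^ 2 + 2 * s * t *
        (a * dirichletForm (toL2 u.pos) (toL2 u.neg)) + t ^ 2 * ‖u.neg‖ ^ 2) +
      b / 4 * (s ^ 2 * dirichletForm (toL2 u.pos) (toL2 u.pos) +
        2 * s * t * dirichletForm (toL2 u.pos) (toL2 u.neg) +
        t ^ 2 * dirichletForm (toL2 u.neg) (toL2 u.neg)) ^ 2 -
      1 / (2 * p) * ((s ^ p) ^ 2 *
          greenForm hα₀ hα₃ (absPow hp (toL2 u.pos)) (absPow hp (toL2 u.pos)) +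
        2 * s ^ p * t ^ p *
          greenForm hα₀ hα₃ (absPow hp (toL2 u.pos)) (absPow hp (toL2 u.neg)) +
        (t ^ p) ^ 2 *
          greenForm hα₀ hα₃ (absPow hp (toL2 u.neg)) (absPow hp (toL2 u.neg))) := by
  rw [energy_eq hα₀ hα₃ hp, lowerTerm, absPow_comb hp hs ht, greenForm_comb, norm_comb_sq,
    dirichletForm_comb, add_sub_assoc]

theorem dirichletForm_eq (u : HSpace ha hh) :
    dirichletForm (toL2 u) (toL2 u) = dirichletForm (toL2 u.pos) (toL2 u.pos) +
      2 * dirichletForm (toL2 u.pos) (toL2 u.neg) +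
      dirichletForm (toL2 u.neg) (toL2 u.neg) := by
  simpa [comb_one_one] using dirichletForm_comb 1 1 u

theorem energyDeriv_pos (hα₀ : 0 < α) (hα₃ : α < 3) (hp : 3 < p) (u : HSpace ha hh) :
    energyDeriv b hα₀ hα₃ hp u u.pos =
      ‖u.pos‖ ^ 2 + a * dirichletForm (toL2 u.pos) (toL2 u.neg) +
      b * dirichletForm (toL2 u) (toL2 u) * (dirichletForm (toL2 u.pos) (toL2 u.pos) +
        dirichletForm (toL2 u.pos) (toL2 u.neg)) -
      (greenForm hα₀ hα₃ (absPow hp (toL2 u.pos)) (absPow hp (toL2 u.pos)) +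
        greenForm hα₀ hα₃ (absPow hp (toL2 u.pos)) (absPow hp (toL2 u.neg))) := by
  have h1 : (inner ℝ u u.pos : ℝ) =
      ‖u.pos‖ ^ 2 + a * dirichletForm (toL2 u.pos) (toL2 u.neg) := by
    have : (inner ℝ u u.pos : ℝ) = inner ℝ (u.pos + u.neg) u.pos := by rw [u.pos_add_neg]
    rw [this, inner_add_left, real_inner_self_eq_norm_sq, real_inner_comm, inner_pos_neg]
  have h2 : dirichletForm (toL2 u) (toL2 u.pos) = dirichletForm (toL2 u.pos) (toL2 u.pos) +
      dirichletForm (toL2 u.pos) (toL2 u.neg) := by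
    have : toL2 u = toL2 u.pos + toL2 u.neg := by rw [← map_add, u.pos_add_neg]
    rw [this, map_add, _root_.add_apply, dirichletForm_comm (toL2 u.neg)]
  rw [energyDeriv_apply, mulL_signedPow_pos, absPow_eq_add, map_add, _root_.add_apply,
    greenForm_comm hα₀ hα₃ (absPow hp (toL2 u.neg)), h1, h2]

theorem energyDeriv_neg (hα₀ : 0 < α) (hα₃ : α < 3) (hp : 3 < p) (u : HSpace ha hh) :
    energyDeriv b hα₀ hα₃ hp u u.neg =
      ‖u.neg‖ ^ 2 + a * dirichletForm (toL2 u.pos) (toL2 u.neg) +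
      b * dirichletForm (toL2 u) (toL2 u) * (dirichletForm (toL2 u.neg) (toL2 u.neg) +
        dirichletForm (toL2 u.pos) (toL2 u.neg)) -
      (greenForm hα₀ hα₃ (absPow hp (toL2 u.neg)) (absPow hp (toL2 u.neg)) +
        greenForm hα₀ hα₃ (absPow hp (toL2 u.pos)) (absPow hp (toL2 u.neg))) := by
  have h1 : (inner ℝ u u.neg : ℝ) =
      ‖u.neg‖ ^ 2 + a * dirichletForm (toL2 u.pos) (toL2 u.neg) := by
    have : (inner ℝ u u.neg : ℝ) = inner ℝ (u.pos + u.neg) u.neg := by rw [u.pos_add_neg]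
    rw [this, inner_add_left, real_inner_self_eq_norm_sq, inner_pos_neg, add_comm]
  have h2 : dirichletForm (toL2 u) (toL2 u.neg) = dirichletForm (toL2 u.neg) (toL2 u.neg) +
      dirichletForm (toL2 u.pos) (toL2 u.neg) := by
    have : toL2 u = toL2 u.pos + toL2 u.neg := by rw [← map_add, u.pos_add_neg]
    rw [this, map_add, _root_.add_apply, add_comm]
  rw [energyDeriv_apply, mulL_signedPow_neg, absPow_eq_add, map_add, _root_.add_apply, h1, h2]
  ring

theorem energyDeriv_self (hα₀ : 0 < α) (hα₃ : α < 3) (hp : 3 < p) (u : HSpace ha hh) :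
    energyDeriv b hα₀ hα₃ hp u u = ‖u‖ ^ 2 + b * dirichletForm (toL2 u) (toL2 u) ^ 2 -
      greenForm hα₀ hα₃ (absPow hp (toL2 u)) (absPow hp (toL2 u)) := by
  have h1 : mulL (signedPow hp (toL2 u)) (toL2 u) = absPow hp (toL2 u) := by
    refine lp.ext (funext fun x => ?_)
    change |u x| ^ (p - 2) * u x * u x = |u x| ^ p
    rw [abs_rpow_eq_sq_mul hp]
    ring
  rw [energyDeriv_apply, h1, real_inner_self_eq_norm_sq]
  ring

/-! ### The fibering inequality -/

theorem one_add_mul_sub_one_le_rpow {x q : ℝ} (hx : 0 ≤ x) (hq : 1 ≤ q) :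
    1 + q * (x - 1) ≤ x ^ q := by
  simpa using one_add_mul_self_le_rpow_one_add (s := x - 1) (by linarith) hq

theorem one_add_mul_sub_one_lt_rpow {x q : ℝ} (hx : 0 ≤ x) (hx1 : x ≠ 1) (hq : 1 < q) :
    1 + q * (x - 1) < x ^ q := by
  simpa using one_add_mul_self_lt_rpow_one_add (s := x - 1) (by linarith) (sub_ne_zero.2 hx1) hq

theorem pow_rpow_div {s : ℝ} (hs : 0 ≤ s) (n : ℕ) [NeZero n] (p : ℝ) :
    (s ^ n) ^ (p / n) = s ^ p := by
  rw [← rpow_natCast, ← rpow_mul hs, mul_div_cancel₀]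
  exact Nat.cast_ne_zero.2 (NeZero.ne n)

/-- The algebraic inequality behind the concavity of `(s^p, t^p) ↦ J(s u⁺ + t u⁻)`. -/
theorem fibering_inequality {a b p P Q C X Y D₁ D₁₂ D₂ s t S T : ℝ} (ha : 0 ≤ a) (hb : 0 ≤ b)
    (hp : 0 < p) (hC : 0 ≤ C) (hX : 0 ≤ X) (hY : 0 ≤ Y)
    (hs : 0 ≤ s) (ht : 0 ≤ t)
    (hS2 : p / 2 * (s ^ 2 - 1) ≤ S - 1) (hT2 : p / 2 * (t ^ 2 - 1) ≤ T - 1)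
    (hS4 : p / 4 * (s ^ 4 - 1) ≤ S - 1) (hT4 : p / 4 * (t ^ 4 - 1) ≤ T - 1)
    (hD : 0 ≤ (S - 1) ^ 2 * D₁ + 2 * (S - 1) * (T - 1) * D₁₂ + (T - 1) ^ 2 * D₂)
    (h₁ : P + a * C + b * (X + 2 * C + Y) * (X + C) - (D₁ + D₁₂) = 0)
    (h₂ : Q + a * C + b * (X + 2 * C + Y) * (Y + C) - (D₂ + D₁₂) = 0) :
    1 / 2 * (s ^ 2 * P + 2 * s * t * (a * C) + t ^ 2 * Q) +
        b / 4 * (s ^ 2 * X + 2 * s * t * C + t ^ 2 * Y) ^ 2 -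
        1 / (2 * p) * (S ^ 2 * D₁ + 2 * S * T * D₁₂ + T ^ 2 * D₂) +
        (P * ((S - 1) / p - (s ^ 2 - 1) / 2) + Q * ((T - 1) / p - (t ^ 2 - 1) / 2)) ≤
      1 / 2 * (P + 2 * (a * C) + Q) + b / 4 * (X + 2 * C + Y) ^ 2 -
        1 / (2 * p) * (D₁ + 2 * D₁₂ + D₂) := by
  -- The increments of `S` and `T`, scaled so that the linear parts of `s²/2`, `s⁴/4` and `S/p` at 1
  -- are all bounded by or equal to the same `σ`.
  obtain ⟨σ, hσ⟩ : ∃ σ, σ = (S - 1) / p := ⟨_, rfl⟩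
  obtain ⟨τ, hτ⟩ : ∃ τ, τ = (T - 1) / p := ⟨_, rfl⟩
  have hS : S = 1 + p * σ := by rw [hσ]; field_simp; ring
  have hT : T = 1 + p * τ := by rw [hτ]; field_simp; ring
  have gS2 : (s ^ 2 - 1) / 2 ≤ σ := by rw [hσ, le_div_iff₀ hp]; linarith
  have gT2 : (t ^ 2 - 1) / 2 ≤ τ := by rw [hτ, le_div_iff₀ hp]; linarith
  have gS4 : (s ^ 4 - 1) / 4 ≤ σ := by rw [hσ, le_div_iff₀ hp]; linarith
  have gT4 : (t ^ 4 - 1) / 4 ≤ τ := by rw [hτ, le_div_iff₀ hp]; linarith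
  -- First `2st ≤ s² + t²`, then Cauchy–Schwarz with weights `X + C` and `Y + C`; its defect is `(X
  -- + C)(Y + C)(s² - t²)²`.
  have hE : (s ^ 2 * X + 2 * s * t * C + t ^ 2 * Y) ^ 2 ≤
      (X + 2 * C + Y) * ((X + C) * s ^ 4 + (Y + C) * t ^ 4) := by
    have h1 : (s ^ 2 * X + 2 * s * t * C + t ^ 2 * Y) ^ 2 ≤
        (s ^ 2 * (X + C) + t ^ 2 * (Y + C)) ^ 2 := by
      refine pow_le_pow_left₀ (by positivity) (le_of_sub_nonneg ?_) 2
      exact (mul_nonneg hC (sq_nonneg (s - t))).trans_eq (by ring)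
    have h2 : 0 ≤ (X + C) * (Y + C) * (s ^ 2 - t ^ 2) ^ 2 := by positivity
    exact h1.trans (le_of_sub_nonneg (h2.trans_eq (by ring)))
  have hDir : b / 4 * (s ^ 2 * X + 2 * s * t * C + t ^ 2 * Y) ^ 2 ≤
      b / 4 * (X + 2 * C + Y) ^ 2 +
        b * (X + 2 * C + Y) * ((X + C) * σ + (Y + C) * τ) := by
    have h1 : (X + C) * s ^ 4 + (Y + C) * t ^ 4 ≤
        (X + C) * (4 * σ + 1) + (Y + C) * (4 * τ + 1) :=
      add_le_add (mul_le_mul_of_nonneg_left (by linarith) (by positivity))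
        (mul_le_mul_of_nonneg_left (by linarith) (by positivity))
    have h2 := mul_le_mul_of_nonneg_left
      (hE.trans (mul_le_mul_of_nonneg_left h1 (by positivity : 0 ≤ X + 2 * C + Y)))
      (by positivity : 0 ≤ b / 4)
    refine h2.trans (le_of_eq ?_)
    ring
  have hCr : s * t * (a * C) ≤ a * C + (a * C) * (σ + τ) := by
    have h1 : s * t ≤ 1 + (σ + τ) := by linarith [two_mul_le_add_sq s t]
    have := mul_le_mul_of_nonneg_right h1 (mul_nonneg ha hC)
    linarith
  -- Exact second-order Taylor expansion of the quadratic form at `(1, 1)`. The remainder is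
  -- nonnegative by `hD`, and the linear part cancels against the two Nehari identities.
  have hG : 1 / (2 * p) * (S ^ 2 * D₁ + 2 * S * T * D₁₂ + T ^ 2 * D₂) =
      1 / (2 * p) * (D₁ + 2 * D₁₂ + D₂) + (σ * (D₁ + D₁₂) + τ * (D₂ + D₁₂)) +
      1 / (2 * p) * ((S - 1) ^ 2 * D₁ + 2 * (S - 1) * (T - 1) * D₁₂ + (T - 1) ^ 2 * D₂) := by
    rw [hS, hT]
    field_simp
    ring
  have hG' : 0 ≤ 1 / (2 * p) *
      ((S - 1) ^ 2 * D₁ + 2 * (S - 1) * (T - 1) * D₁₂ + (T - 1) ^ 2 * D₂) := by positivity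
  have e₁ : σ * (P + a * C + b * (X + 2 * C + Y) * (X + C) - (D₁ + D₁₂)) = 0 := by
    rw [h₁, mul_zero]
  have e₂ : τ * (Q + a * C + b * (X + 2 * C + Y) * (Y + C) - (D₂ + D₁₂)) = 0 := by
    rw [h₂, mul_zero]
  rw [← hσ, ← hτ, hG]
  linarith

/-! ### The Nehari set -/

theorem mem_signChangingNehari_iff (hα₀ : 0 < α) (hα₃ : α < 3) (hp : 3 < p) {u : HSpace ha hh} :
    u ∈ signChangingNehari ha hh b α p ↔ u.pos ≠ 0 ∧ u.neg ≠ 0 ∧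
      energyDeriv b hα₀ hα₃ hp u u.pos = 0 ∧ energyDeriv b hα₀ hα₃ hp u u.neg = 0 := by
  rw [signChangingNehari, mem_ofPred_eq, fderiv_energy hα₀ hα₃ hp]

/-- The terms in `‖u⁺‖²` and `‖u⁻‖²` keep their Bernoulli defect instead of discarding it; this
defect is positive away from 1 and is the source of strictness. -/
theorem energy_comb_add_le (hb : 0 < b) (hα₀ : 0 < α) (hα₃ : α < 3) (hp : 4 < p)
    {u : HSpace ha hh} (hu : u ∈ signChangingNehari ha hh b α p) {s t : ℝ} (hs : 0 ≤ s)
    (ht : 0 ≤ t) :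
    energy b α p (comb s t u) + (‖u.pos‖ ^ 2 * ((s ^ p - 1) / p - (s ^ 2 - 1) / 2) +
      ‖u.neg‖ ^ 2 * ((t ^ p - 1) / p - (t ^ 2 - 1) / 2)) ≤ energy b α p u := by
  have hp3 : 3 < p := by linarith
  obtain ⟨-, -, h₁, h₂⟩ := (mem_signChangingNehari_iff hα₀ hα₃ hp3).1 hu
  rw [energyDeriv_pos, dirichletForm_eq] at h₁
  rw [energyDeriv_neg, dirichletForm_eq] at h₂
  -- Bernoulli for `r²` and `r⁴` with exponents `p / 2` and `p / 4`; the second must be at least 1,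
  -- which is where `4 < p` enters.
  have hbern : ∀ r : ℝ, 0 ≤ r →
      p / 2 * (r ^ 2 - 1) ≤ r ^ p - 1 ∧ p / 4 * (r ^ 4 - 1) ≤ r ^ p - 1 := fun r hr => by
    have e2 := one_add_mul_sub_one_le_rpow (pow_nonneg hr 2)
      (by norm_num; linarith : 1 ≤ p / (2 : ℕ))
    have e4 := one_add_mul_sub_one_le_rpow (pow_nonneg hr 4)
      (by norm_num; linarith : 1 ≤ p / (4 : ℕ))
    rw [pow_rpow_div hr] at e2 e4
    push_cast at e2 e4
    constructor <;> linarith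
  -- Semidefiniteness on the span of `|u⁺|^p` and `|u⁻|^p` gives concavity of the Choquard term in
  -- `(s^p, t^p)`.
  have hD := greenForm_self_nonneg hα₀ hα₃ ((s ^ p - 1) • absPow hp3 (toL2 u.pos) +
    (t ^ p - 1) • absPow hp3 (toL2 u.neg))
  rw [greenForm_comb] at hD
  have key := fibering_inequality ha.le hb.le (by linarith : 0 < p)
    (dirichletForm_pos_neg_nonneg u) (dirichletForm_self_nonneg _) (dirichletForm_self_nonneg _)
    hs ht (hbern s hs).1 (hbern t ht).1 (hbern s hs).2 (hbern t ht).2 hD h₁ h₂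
  have h1 := energy_comb (b := b) hα₀ hα₃ hp3 zero_le_one zero_le_one u
  rw [comb_one_one] at h1
  simp only [one_rpow, one_pow, one_mul, mul_one] at h1
  rw [h1, energy_comb hα₀ hα₃ hp3 hs ht]
  exact key

theorem rpow_sub_one_div_sub_nonneg (hp : 4 < p) {s : ℝ} (hs : 0 ≤ s) :
    0 ≤ (s ^ p - 1) / p - (s ^ 2 - 1) / 2 := by
  have e2 := one_add_mul_sub_one_le_rpow (pow_nonneg hs 2)
    (by norm_num; linarith : 1 ≤ p / (2 : ℕ))
  rw [pow_rpow_div hs] at e2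
  push_cast at e2
  rw [sub_nonneg, le_div_iff₀ (by linarith)]
  linarith

theorem rpow_sub_one_div_sub_pos (hp : 4 < p) {s : ℝ} (hs : 0 ≤ s) (hs1 : s ≠ 1) :
    0 < (s ^ p - 1) / p - (s ^ 2 - 1) / 2 := by
  have hne : s ^ 2 ≠ 1 := fun h1 => hs1 (by nlinarith)
  have e2 := one_add_mul_sub_one_lt_rpow (pow_nonneg hs 2) hne
    (by norm_num; linarith : 1 < p / (2 : ℕ))
  rw [pow_rpow_div hs] at e2
  push_cast at e2
  rw [sub_pos, lt_div_iff₀ (by linarith)]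
  linarith

theorem energy_comb_le (hb : 0 < b) (hα₀ : 0 < α) (hα₃ : α < 3) (hp : 4 < p)
    {u : HSpace ha hh} (hu : u ∈ signChangingNehari ha hh b α p) {s t : ℝ} (hs : 0 ≤ s)
    (ht : 0 ≤ t) : energy b α p (comb s t u) ≤ energy b α p u := by
  have h1 := energy_comb_add_le hb hα₀ hα₃ hp hu hs ht
  have h2 := mul_nonneg (sq_nonneg ‖u.pos‖) (rpow_sub_one_div_sub_nonneg hp hs)
  have h3 := mul_nonneg (sq_nonneg ‖u.neg‖) (rpow_sub_one_div_sub_nonneg hp ht)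
  linarith

theorem energy_comb_lt (hb : 0 < b) (hα₀ : 0 < α) (hα₃ : α < 3) (hp : 4 < p)
    {u : HSpace ha hh} (hu : u ∈ signChangingNehari ha hh b α p) {s t : ℝ} (hs : 0 ≤ s)
    (ht : 0 ≤ t) (hst : (s, t) ≠ (1, 1)) : energy b α p (comb s t u) < energy b α p u := by
  have h1 := energy_comb_add_le hb hα₀ hα₃ hp hu hs ht
  have h2 := mul_nonneg (sq_nonneg ‖u.pos‖) (rpow_sub_one_div_sub_nonneg hp hs)
  have h3 := mul_nonneg (sq_nonneg ‖u.neg‖) (rpow_sub_one_div_sub_nonneg hp ht)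
  have hpos : 0 < ‖u.pos‖ := norm_pos_iff.2 hu.1
  have hneg : 0 < ‖u.neg‖ := norm_pos_iff.2 hu.2.1
  rcases eq_or_ne s 1 with rfl | hs1
  · have ht1 : t ≠ 1 := fun h => hst (by rw [h])
    have := mul_pos (pow_pos hneg 2) (rpow_sub_one_div_sub_pos hp ht ht1)
    linarith
  · have := mul_pos (pow_pos hpos 2) (rpow_sub_one_div_sub_pos hp hs hs1)
    linarith

theorem continuous_comb (u : HSpace ha hh) : Continuous fun q : ℝ × ℝ => comb q.1 q.2 u := by
  unfold comb
  fun_prop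

theorem continuous_energy (hα₀ : 0 < α) (hα₃ : α < 3) (hp : 3 < p) :
    Continuous (energy b α p : HSpace ha hh → ℝ) :=
  (differentiable_energy hα₀ hα₃ hp).continuous

/-- The partial derivatives of the fibre at `(s, t)` are `J'` applied to `u⁺` and `u⁻`, while the
parts of the combination are `s u⁺` and `t u⁻`, mere multiples of these. -/
theorem comb_mem_signChangingNehari (hα₀ : 0 < α) (hα₃ : α < 3) (hp : 3 < p) {u : HSpace ha hh}
    (hpos : u.pos ≠ 0) (hneg : u.neg ≠ 0) {q : ℝ × ℝ} (h1 : 0 < q.1) (h2 : 0 < q.2)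
    (hq : IsLocalMax (fun q : ℝ × ℝ => energy b α p (comb q.1 q.2 u)) q) :
    comb q.1 q.2 u ∈ signChangingNehari ha hh b α p := by
  rw [mem_signChangingNehari_iff hα₀ hα₃ hp, comb_pos h1.le h2.le, comb_neg h1.le h2.le, map_smul,
    map_smul]
  have hd := (hasStrictFDerivAt_energy (b := b) hα₀ hα₃ hp (comb q.1 q.2 u)).hasFDerivAt
  have d1 : HasDerivAt (fun s => comb s q.2 u) u.pos q.1 := by
    simpa [comb] using ((hasDerivAt_id q.1).smul_const u.pos).add_const (q.2 • u.neg)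
  have d2 : HasDerivAt (fun t => comb q.1 t u) u.neg q.2 := by
    simpa [comb] using ((hasDerivAt_id q.2).smul_const u.neg).const_add (q.1 • u.pos)
  have m1 : IsLocalMax (fun s => energy b α p (comb s q.2 u)) q.1 :=
    IsLocalMax.comp_continuous (g := fun s => (s, q.2)) (b := q.1) hq
      (by fun_prop : Continuous fun s : ℝ => (s, q.2)).continuousAt
  have m2 : IsLocalMax (fun t => energy b α p (comb q.1 t u)) q.2 :=
    IsLocalMax.comp_continuous (g := fun t => (q.1, t)) (b := q.2) hq
      (by fun_prop : Continuous fun t : ℝ => (q.1, t)).continuousAt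
  refine ⟨smul_ne_zero h1.ne' hpos, smul_ne_zero h2.ne' hneg, ?_, ?_⟩
  · rw [m1.hasDerivAt_eq_zero (hd.comp_hasDerivAt (f := fun s => comb s q.2 u) q.1 d1), smul_zero]
  · rw [m2.hasDerivAt_eq_zero (hd.comp_hasDerivAt (f := fun t => comb q.1 t u) q.2 d2), smul_zero]

end Parts

section Existence

variable {a b α p : ℝ} {h : Z3 → ℝ} {ha : 0 < a} {hh : UniformlyPositive h}

/-! ### Projection onto the Nehari set -/

theorem HSpace.exists_pos_of_pos_ne_zero {u : HSpace ha hh} (hu : u.pos ≠ 0) : ∃ x, 0 < u x := by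
  by_contra! hle
  exact hu (HSpace.ext fun x => max_eq_right (hle x))

theorem HSpace.exists_neg_of_neg_ne_zero {u : HSpace ha hh} (hu : u.neg ≠ 0) : ∃ x, u x < 0 := by
  by_contra! hle
  exact hu (HSpace.ext fun x => min_eq_right (hle x))

theorem eventually_rpow_lt_mul_sq (hp : 3 < p) {A : ℝ} (hA : 0 < A) (B₁ B₂ : ℝ) :
    ∀ᶠ s in 𝓝[>] (0 : ℝ), (s ^ p) ^ 2 * B₁ + s ^ p * B₂ < A * s ^ 2 := by
  -- Absolute values give a function continuous at the origin from both sides, which vanishes there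
  -- because `p > 2`.
  have hc : Continuous fun s : ℝ => |s| ^ (p - 2) * (|s| ^ p * B₁ + B₂) := by
    have h1 : Continuous fun s : ℝ => |s| ^ (p - 2) :=
      continuous_abs.rpow_const fun _ => Or.inr (by linarith)
    have h2 : Continuous fun s : ℝ => |s| ^ p :=
      continuous_abs.rpow_const fun _ => Or.inr (by linarith)
    fun_prop
  have h0 : ∀ᶠ s in 𝓝 (0 : ℝ), |s| ^ (p - 2) * (|s| ^ p * B₁ + B₂) < A :=
    (isOpen_lt hc continuous_const).mem_nhds
      (by simpa [zero_rpow (by linarith : p - 2 ≠ 0)] using hA)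
  filter_upwards [nhdsWithin_le_nhds h0, self_mem_nhdsWithin] with s hs hs0
  have hs0' : (0 : ℝ) < s := hs0
  have := mul_lt_mul_of_pos_right hs (pow_pos hs0' 2)
  rw [abs_of_pos hs0'] at this
  have h3 := abs_rpow_eq_sq_mul hp s
  rw [abs_of_pos hs0'] at h3
  calc (s ^ p) ^ 2 * B₁ + s ^ p * B₂ = s ^ p * (s ^ p * B₁ + B₂) := by ring
    _ = s ^ (p - 2) * (s ^ p * B₁ + B₂) * s ^ 2 := by
        nth_rewrite 1 [h3]
        ring
    _ < A * s ^ 2 := this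

theorem energy_zero (hα₀ : 0 < α) (hα₃ : α < 3) (hp : 3 < p) :
    energy b α p (0 : HSpace ha hh) = 0 := by
  have : absPow hp (0 : L2) = 0 := lp.ext (funext fun x => by
    change |(0 : ℝ)| ^ p = 0
    rw [abs_zero, zero_rpow (by linarith)])
  rw [energy_eq hα₀ hα₃ hp, lowerTerm, map_zero, this]
  simp

theorem dirichletForm_le_norm_sq (u : HSpace ha hh) :
    a * dirichletForm (toL2 u) (toL2 u) ≤ ‖u‖ ^ 2 := by
  rw [u.norm_sq_eq]
  refine le_add_of_nonneg_right (tsum_nonneg fun x => ?_)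
  exact mul_nonneg (hh.nonneg x) (sq_nonneg _)

/-- With `r = max s t ≥ 1`, the norm and Kirchhoff terms are `O(r⁴)`. The Green's form is bounded
below by its value at one point where the part carrying the larger coefficient is nonzero, hence by
a multiple of `r^{2p} ≥ r⁵`. -/
theorem exists_forall_energy_comb_neg (hb : 0 < b) (hα₀ : 0 < α) (hα₃ : α < 3) (hp : 3 < p)
    {u : HSpace ha hh} (hpos : u.pos ≠ 0) (hneg : u.neg ≠ 0) :
    ∃ R > 0, ∀ s t, 0 ≤ s → 0 ≤ t → R ≤ max s t → energy b α p (comb s t u) < 0 := by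
  obtain ⟨x, hx⟩ := HSpace.exists_pos_of_pos_ne_zero hpos
  obtain ⟨y, hy⟩ := HSpace.exists_neg_of_neg_ne_zero hneg
  obtain ⟨δ, hδ, hδx, hδy⟩ : ∃ δ > 0, δ ≤ |u x| ∧ δ ≤ |u y| :=
    ⟨min |u x| |u y|, lt_min (abs_pos.2 hx.ne') (abs_pos.2 hy.ne), min_le_left _ _,
      min_le_right _ _⟩
  obtain ⟨K, hK⟩ : ∃ K, K = (‖u.pos‖ + ‖u.neg‖) ^ 2 := ⟨_, rfl⟩
  have hK0 : 0 ≤ K := hK ▸ sq_nonneg _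
  obtain ⟨c, hc⟩ : ∃ c, c = 1 / (2 * p) * (greenLower α * (δ ^ p) ^ 2) := ⟨_, rfl⟩
  have hc0 : 0 < c := by
    have := greenLower_pos hα₀
    have : 0 < p := by linarith
    rw [hc]
    positivity
  obtain ⟨A, hA⟩ : ∃ A, A = 1 / 2 * K + b / 4 * (K / a) ^ 2 := ⟨_, rfl⟩
  have hA0 : 0 ≤ A := by rw [hA]; positivity
  refine ⟨1 + A / c, by positivity, fun s t hs ht hR => ?_⟩
  obtain ⟨r, hr⟩ : ∃ r, r = max s t := ⟨_, rfl⟩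
  rw [← hr] at hR
  have hr1 : 1 ≤ r := le_trans (le_add_of_nonneg_right (by positivity)) hR
  have hAr : A < c * r := by
    have := mul_le_mul_of_nonneg_left hR hc0.le
    rw [mul_add, mul_div_cancel₀ _ hc0.ne'] at this
    linarith
  have hnorm : ‖comb s t u‖ ^ 2 ≤ K * r ^ 2 := by
    have h1 : ‖comb s t u‖ ≤ (‖u.pos‖ + ‖u.neg‖) * r := by
      refine (norm_add_le _ _).trans ?_
      rw [norm_smul, norm_smul, norm_of_nonneg hs, norm_of_nonneg ht, add_mul, hr, mul_comm s,
        mul_comm t]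
      gcongr
      · exact le_max_left _ _
      · exact le_max_right _ _
    calc _ ≤ ((‖u.pos‖ + ‖u.neg‖) * r) ^ 2 := pow_le_pow_left₀ (norm_nonneg _) h1 2
      _ = _ := by rw [mul_pow, hK]
  have hdir : dirichletForm (toL2 (comb s t u)) (toL2 (comb s t u)) ≤ K / a * r ^ 2 := by
    rw [div_mul_eq_mul_div, le_div_iff₀' ha]
    exact (dirichletForm_le_norm_sq _).trans hnorm
  have hgreen : greenLower α * ((δ ^ p) ^ 2 * r ^ 5) ≤
      greenForm hα₀ hα₃ (absPow hp (toL2 (comb s t u))) (absPow hp (toL2 (comb s t u))) := by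
    have key : ∀ z : Z3, δ * r ≤ |comb s t u z| → greenLower α * ((δ ^ p) ^ 2 * r ^ 5) ≤
        greenForm hα₀ hα₃ (absPow hp (toL2 (comb s t u))) (absPow hp (toL2 (comb s t u))) := by
      intro z hz
      refine le_trans (mul_le_mul_of_nonneg_left ?_ (greenLower_pos hα₀).le)
        (greenLower_mul_sum_sq_le_greenForm hα₀ hα₃ _ {z})
      rw [Finset.sum_singleton, absPow_apply, toL2_apply]
      calc (δ ^ p) ^ 2 * r ^ 5 ≤ (δ ^ p) ^ 2 * (r ^ p) ^ 2 := by
            refine mul_le_mul_of_nonneg_left ?_ (sq_nonneg _)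
            rw [← rpow_natCast, ← rpow_natCast, ← rpow_mul (by linarith)]
            refine rpow_le_rpow_of_exponent_le hr1 ?_
            push_cast
            linarith
        _ = ((δ * r) ^ p) ^ 2 := by rw [mul_rpow hδ.le (by linarith), mul_pow]
        _ ≤ _ := by
            have : 0 ≤ δ * r := by positivity
            gcongr
    rcases le_total s t with hst | hst
    · refine key y ?_
      rw [comb_apply, max_eq_right hy.le, min_eq_left hy.le, mul_zero, zero_add, abs_mul,
        abs_of_nonneg ht, hr, max_eq_right hst, mul_comm]
      exact mul_le_mul_of_nonneg_left hδy ht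
    · refine key x ?_
      rw [comb_apply, max_eq_left hx.le, min_eq_right hx.le, mul_zero, add_zero, abs_mul,
        abs_of_nonneg hs, hr, max_eq_left hst, mul_comm]
      exact mul_le_mul_of_nonneg_left hδx hs
  have hdir2 := pow_le_pow_left₀ (dirichletForm_self_nonneg (toL2 (comb s t u))) hdir 2
  have e1 : 1 / 2 * ‖comb s t u‖ ^ 2 ≤ 1 / 2 * K * r ^ 4 := by
    have : r ^ 2 ≤ r ^ 4 := pow_le_pow_right₀ hr1 (by norm_num)
    have := mul_le_mul_of_nonneg_left this hK0
    linarith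
  have e2 := mul_le_mul_of_nonneg_left hdir2 (by positivity : 0 ≤ b / 4)
  have e3 := mul_le_mul_of_nonneg_left hgreen
    (one_div_nonneg.2 (by linarith) : 0 ≤ 1 / (2 * p))
  have e4 : A * r ^ 4 < c * r * r ^ 4 := mul_lt_mul_of_pos_right hAr (by positivity)
  rw [energy_eq hα₀ hα₃ hp, lowerTerm]
  rw [hA, hc] at e4
  linarith

/-- Leaving the axis gains `½ r² P`, whereas the Choquard terms cost only `O(r^p)`, including the
cross term `D₁₂`, whose sign is unknown. -/
theorem eventually_fiber_lt (hp : 3 < p) (hb : 0 ≤ b) {P A C X Y t : ℝ} (hP : 0 < P)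
    (hA : 0 ≤ A) (hC : 0 ≤ C) (hX : 0 ≤ X) (hY : 0 ≤ Y) (ht : 0 ≤ t) (Q D₁ D₁₂ D₂ T : ℝ) :
    ∀ᶠ r in 𝓝[>] (0 : ℝ), 1 / 2 * (t ^ 2 * Q) + b / 4 * (t ^ 2 * Y) ^ 2 -
        1 / (2 * p) * (T ^ 2 * D₂) <
      1 / 2 * (r ^ 2 * P + 2 * r * t * A + t ^ 2 * Q) +
        b / 4 * (r ^ 2 * X + 2 * r * t * C + t ^ 2 * Y) ^ 2 -
        1 / (2 * p) * ((r ^ p) ^ 2 * D₁ + 2 * r ^ p * T * D₁₂ + T ^ 2 * D₂) := by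
  filter_upwards [eventually_rpow_lt_mul_sq hp (half_pos hP) (1 / (2 * p) * D₁)
    (1 / (2 * p) * (2 * T * D₁₂)), self_mem_nhdsWithin] with r hr hr1
  have hr0 : 0 < r := hr1
  have h2 : (t ^ 2 * Y) ^ 2 ≤ (r ^ 2 * X + 2 * r * t * C + t ^ 2 * Y) ^ 2 :=
    pow_le_pow_left₀ (by positivity) (le_add_of_nonneg_left (by positivity)) 2
  have h3 := mul_le_mul_of_nonneg_left h2 (by positivity : 0 ≤ b / 4)
  have h4 : 0 ≤ r * t * A := by positivity
  linarith

theorem eventually_energy_comb_lt_left (hb : 0 < b) (hα₀ : 0 < α) (hα₃ : α < 3) (hp : 3 < p)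
    {u : HSpace ha hh} (hpos : u.pos ≠ 0) {t : ℝ} (ht : 0 ≤ t) :
    ∀ᶠ r in 𝓝[>] (0 : ℝ), energy b α p (comb 0 t u) < energy b α p (comb r t u) := by
  have hC := dirichletForm_pos_neg_nonneg u
  filter_upwards [eventually_fiber_lt hp hb.le (pow_pos (norm_pos_iff.2 hpos) 2)
    (mul_nonneg ha.le hC) hC (dirichletForm_self_nonneg (toL2 u.pos))
    (dirichletForm_self_nonneg (toL2 u.neg)) ht (‖u.neg‖ ^ 2)
    (greenForm hα₀ hα₃ (absPow hp (toL2 u.pos)) (absPow hp (toL2 u.pos)))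
    (greenForm hα₀ hα₃ (absPow hp (toL2 u.pos)) (absPow hp (toL2 u.neg)))
    (greenForm hα₀ hα₃ (absPow hp (toL2 u.neg)) (absPow hp (toL2 u.neg))) (t ^ p),
    self_mem_nhdsWithin] with r hr hr0
  rw [energy_comb hα₀ hα₃ hp (le_of_lt hr0) ht, energy_comb hα₀ hα₃ hp le_rfl ht,
    zero_rpow (by linarith : p ≠ 0)]
  refine lt_of_eq_of_lt ?_ hr
  ring

theorem HSpace.neg_pos_eq (u : HSpace ha hh) : (-u).pos = -u.neg :=
  HSpace.ext fun x => by
    change max (-u x) 0 = -min (u x) 0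
    rw [← max_neg_neg, neg_zero]

theorem HSpace.neg_neg_eq (u : HSpace ha hh) : (-u).neg = -u.pos :=
  HSpace.ext fun x => by
    change min (-u x) 0 = -max (u x) 0
    rw [← min_neg_neg, neg_zero]

theorem comb_neg_eq (s t : ℝ) (u : HSpace ha hh) : comb s t (-u) = -comb t s u := by
  rw [comb, comb, u.neg_pos_eq, u.neg_neg_eq, smul_neg, smul_neg, neg_add, add_comm]

theorem energy_neg (hα₀ : 0 < α) (hα₃ : α < 3) (hp : 3 < p) (u : HSpace ha hh) :
    energy b α p (-u) = energy b α p u := by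
  have : absPow hp (-toL2 u) = absPow hp (toL2 u) := lp.ext (funext fun x => by
    change |-u x| ^ p = |u x| ^ p
    rw [abs_neg])
  rw [energy_eq hα₀ hα₃ hp, energy_eq hα₀ hα₃ hp, lowerTerm, lowerTerm, map_neg, norm_neg, this]
  simp only [map_neg, _root_.neg_apply, neg_neg]

/-- `J` is even, and `u ↦ -u` exchanges the two parts up to sign. -/
theorem eventually_energy_comb_lt_right (hb : 0 < b) (hα₀ : 0 < α) (hα₃ : α < 3) (hp : 3 < p)
    {u : HSpace ha hh} (hneg : u.neg ≠ 0) {s : ℝ} (hs : 0 ≤ s) :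
    ∀ᶠ r in 𝓝[>] (0 : ℝ), energy b α p (comb s 0 u) < energy b α p (comb s r u) := by
  have h1 := eventually_energy_comb_lt_left hb hα₀ hα₃ hp (u := -u)
    (by rwa [u.neg_pos_eq, neg_ne_zero]) hs
  simpa only [comb_neg_eq, energy_neg hα₀ hα₃ hp] using h1

theorem exists_comb_mem_signChangingNehari (hb : 0 < b) (hα₀ : 0 < α) (hα₃ : α < 3) (hp : 3 < p)
    {u : HSpace ha hh} (hpos : u.pos ≠ 0) (hneg : u.neg ≠ 0) :
    ∃ s t, 0 < s ∧ 0 < t ∧ comb s t u ∈ signChangingNehari ha hh b α p := by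
  obtain ⟨R, hR, hneg_energy⟩ := exists_forall_energy_comb_neg hb hα₀ hα₃ hp hpos hneg
  have hcont : Continuous fun q : ℝ × ℝ => energy b α p (comb q.1 q.2 u) :=
    (continuous_energy hα₀ hα₃ hp).comp (continuous_comb u)
  obtain ⟨q, hq, hmax⟩ := ((isCompact_Icc (a := (0 : ℝ)) (b := R)).prod
    (isCompact_Icc (a := (0 : ℝ)) (b := R))).exists_isMaxOn ⟨(0, 0), by simp [hR.le]⟩
    hcont.continuousOn
  obtain ⟨s, t⟩ := q
  obtain ⟨hs, ht⟩ := mem_prod.1 hq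
  obtain ⟨hs0, hsR⟩ := mem_Icc.1 hs
  obtain ⟨ht0, htR⟩ := mem_Icc.1 ht
  clear hs ht hq
  have hmax' : ∀ s' t', 0 ≤ s' → s' ≤ R → 0 ≤ t' → t' ≤ R →
      energy b α p (comb s' t' u) ≤ energy b α p (comb s t u) := fun s' t' h1 h2 h3 h4 =>
    isMaxOn_iff.1 hmax (s', t') (mem_prod.2 ⟨mem_Icc.2 ⟨h1, h2⟩, mem_Icc.2 ⟨h3, h4⟩⟩)
  -- The origin has energy zero, so the maximum cannot lie on the outer sides of the square, where
  -- the energy is negative.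
  have hnonneg : 0 ≤ energy b α p (comb s t u) := by
    have h1 := hmax' 0 0 le_rfl hR.le le_rfl hR.le
    rwa [show comb 0 0 u = 0 by simp [comb], energy_zero hα₀ hα₃ hp] at h1
  have hlt : max s t < R := by
    by_contra! hle
    exact (hneg_energy s t hs0 ht0 hle).not_ge hnonneg
  obtain ⟨hsR', htR'⟩ := max_lt_iff.1 hlt
  have hnear : ∀ᶠ r in 𝓝[>] (0 : ℝ), 0 < r ∧ r ≤ R := by
    filter_upwards [self_mem_nhdsWithin, nhdsWithin_le_nhds (Iio_mem_nhds hR)] with r h1 h2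
    exact ⟨h1, le_of_lt h2⟩
  have hs : 0 < s := by
    refine hs0.lt_of_ne' ?_
    rintro rfl
    obtain ⟨r, hr, hr0, hrR⟩ :=
      ((eventually_energy_comb_lt_left (b := b) hb hα₀ hα₃ hp hpos ht0).and hnear).exists
    exact (hmax' r t hr0.le hrR ht0 htR).not_gt hr
  have ht : 0 < t := by
    refine ht0.lt_of_ne' ?_
    rintro rfl
    obtain ⟨r, hr, hr0, hrR⟩ :=
      ((eventually_energy_comb_lt_right (b := b) hb hα₀ hα₃ hp hneg hs0).and hnear).exists
    exact (hmax' s r hs0 hsR hr0.le hrR).not_gt hr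
  refine ⟨s, t, hs, ht, comb_mem_signChangingNehari hα₀ hα₃ hp hpos hneg hs ht
    (hmax.isLocalMax ?_)⟩
  exact prod_mem_nhds (Icc_mem_nhds hs hsR') (Icc_mem_nhds ht htR')

/-! ### Lower bounds on the Nehari set -/

/-- Subtract `(1/(2p)) (J'(u), u) = 0` to eliminate the Choquard term. As `1/(2p) ≤ 1/8`, at least
`3/8` of `‖u‖²` and a nonnegative Kirchhoff term remain. -/
theorem norm_sq_le_energy (hb : 0 < b) (hα₀ : 0 < α) (hα₃ : α < 3) (hp : 4 < p)
    {u : HSpace ha hh} (hu : u ∈ signChangingNehari ha hh b α p) :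
    1 / 4 * ‖u‖ ^ 2 ≤ energy b α p u := by
  have hp3 : 3 < p := by linarith
  obtain ⟨-, -, h₁, h₂⟩ := (mem_signChangingNehari_iff hα₀ hα₃ hp3).1 hu
  have h0 : energyDeriv b hα₀ hα₃ hp3 u u = 0 := by
    have h1 : energyDeriv b hα₀ hα₃ hp3 u (u.pos + u.neg) = 0 := by
      rw [map_add, h₁, h₂, add_zero]
    rwa [u.pos_add_neg] at h1
  rw [energyDeriv_self] at h0
  rw [energy_eq hα₀ hα₃ hp3, lowerTerm]
  have hg : greenForm hα₀ hα₃ (absPow hp3 (toL2 u)) (absPow hp3 (toL2 u)) =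
    ‖u‖ ^ 2 + b * dirichletForm (toL2 u) (toL2 u) ^ 2 := by linarith
  have hp8 : 1 / (2 * p) ≤ 1 / 8 := one_div_le_one_div_of_le (by norm_num) (by linarith)
  have h3 : 0 ≤ b * dirichletForm (toL2 u) (toL2 u) ^ 2 := by positivity
  have h4 := mul_le_mul_of_nonneg_right hp8 (add_nonneg (sq_nonneg ‖u‖) h3)
  rw [hg]
  linarith [sq_nonneg ‖u‖]

end Existence

/-! ### Balls of the lattice are finite -/

theorem sum_abs_sub_le_length {x y : Z3} (w : lattice.Walk x y) :
    ∑ i, |x i - y i| ≤ (w.length : ℤ) := by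
  induction w with
  | nil => simp
  | @cons x z y hxz w ih =>
    have h1 : ∑ i, |x i - z i| = 1 := hxz
    have h2 : ∑ i, |x i - y i| ≤ ∑ i, (|x i - z i| + |z i - y i|) :=
      Finset.sum_le_sum fun i _ => abs_sub_le _ _ _
    rw [Finset.sum_add_distrib, h1] at h2
    rw [SimpleGraph.Walk.length_cons]
    push_cast
    linarith

theorem lattice_adj_add_single (x : Z3) (i : Fin 3) : lattice.Adj x (x + Pi.single i 1) := by
  change ∑ j, |x j - (x + Pi.single i 1 : Z3) j| = 1
  rw [Finset.sum_eq_single i]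
  · simp
  · intro j _ hj
    simp [Pi.single_eq_of_ne hj]
  · simp

theorem lattice_reachable_add_single (i : Fin 3) (n : ℕ) (x : Z3) :
    lattice.Reachable x (x + Pi.single i (n : ℤ)) := by
  induction n with
  | zero => simp
  | succ n ih =>
    refine ih.trans ?_
    have h1 := (lattice_adj_add_single (x + Pi.single i (n : ℤ)) i).reachable
    rwa [add_assoc, ← Pi.single_add] at h1

theorem lattice_reachable_add_single_int (i : Fin 3) (k : ℤ) (x : Z3) :
    lattice.Reachable x (x + Pi.single i k) := by
  obtain ⟨n, rfl | rfl⟩ := k.eq_nat_or_neg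
  · exact lattice_reachable_add_single i n x
  · have h1 := lattice_reachable_add_single i n (x + Pi.single i (-(n : ℤ)))
    rw [add_assoc, ← Pi.single_add, neg_add_cancel, Pi.single_zero, add_zero] at h1
    exact h1.symm

/-- Needed because `SimpleGraph.dist` is 0 between unreachable vertices; only connectedness makes
distance balls bounded. -/
theorem lattice_reachable (x y : Z3) : lattice.Reachable x y := by
  have h1 : y = x + Pi.single 0 (y 0 - x 0) + Pi.single 1 (y 1 - x 1) +
      Pi.single 2 (y 2 - x 2) := by
    funext i
    fin_cases i <;> simp
  rw [h1]
  exact ((lattice_reachable_add_single_int 0 _ _).trans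
    (lattice_reachable_add_single_int 1 _ _)).trans (lattice_reachable_add_single_int 2 _ _)

theorem finite_dist_lt (x₀ : Z3) (r : ℕ) : {x : Z3 | lattice.dist x x₀ < r}.Finite := by
  refine (finite_Icc (x₀ - fun _ => (r : ℤ)) (x₀ + fun _ => (r : ℤ))).subset fun x hx => ?_
  obtain ⟨w, hw⟩ := (lattice_reachable x x₀).exists_walk_length_eq_dist
  have h1 := sum_abs_sub_le_length w
  rw [hw] at h1
  have h2 : (lattice.dist x x₀ : ℤ) < r := by exact_mod_cast hx
  have h3 : ∀ i, |x i - x₀ i| ≤ r := fun i =>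
    (Finset.single_le_sum (f := fun i => |x i - x₀ i|) (fun _ _ => abs_nonneg _)
      (Finset.mem_univ i)).trans (h1.trans h2.le)
  refine ⟨fun i => ?_, fun i => ?_⟩ <;>
  · have := abs_le.1 (h3 i)
    simp only [Pi.sub_apply, Pi.add_apply]
    omega

theorem Coercive.finite_lt {h : Z3 → ℝ} (h₃ : Coercive h) (M : ℝ) : {x | h x < M}.Finite := by
  obtain ⟨x₀, hx₀⟩ := h₃
  obtain ⟨r, hr⟩ := hx₀ M
  refine (finite_dist_lt x₀ r).subset fun x hx => ?_
  by_contra hle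
  exact (hr x (not_lt.1 hle)).not_gt hx

theorem L2.norm_le_of_abs_le {f g : L2} (hfg : ∀ x, |f x| ≤ |g x|) : ‖f‖ ≤ ‖g‖ := by
  refine abs_le_of_sq_le_sq' ?_ (norm_nonneg _) |>.2
  rw [f.norm_sq_eq, g.norm_sq_eq]
  exact f.summable_sq.tsum_le_tsum (fun x => sq_le_sq.2 (hfg x)) g.summable_sq

theorem L2.tendsto_apply {f : ℕ → L2} {g : L2} (hf : Tendsto f atTop (𝓝 g)) (x : Z3) :
    Tendsto (fun n => f n x) atTop (𝓝 (g x)) :=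
  ((lp.evalCLM ℝ (fun _ : Z3 => ℝ) 2 x).continuous.tendsto g).comp hf

section Compactness

variable {a b α p : ℝ} {h : Z3 → ℝ} {ha : 0 < a} {hh : UniformlyPositive h}

/-! ### Compactness of the embedding `H → ℓ²` -/

/-- Off the finite set `{h < M}` the squared `ℓ²` mass is at most `M⁻¹ ∫ h (uₙ - v)²`, uniformly
small in `n`; on that set pointwise convergence is enough. -/
theorem tendsto_toL2_of_pointwise (h₃ : Coercive h) {u : ℕ → HSpace ha hh} {v : HSpace ha hh}
    {B : ℝ} (hB : ∀ n, ‖u n‖ ≤ B) (huv : ∀ x, Tendsto (fun n => u n x) atTop (𝓝 (v x))) :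
    Tendsto (fun n => toL2 (u n)) atTop (𝓝 (toL2 v)) := by
  rw [tendsto_iff_norm_sub_tendsto_zero]
  have hsq : Tendsto (fun n => ‖toL2 (u n) - toL2 v‖ ^ 2) atTop (𝓝 0) := by
    rw [Metric.tendsto_atTop]
    intro ε hε
    obtain ⟨K, hK⟩ : ∃ K, K = (B + ‖v‖) ^ 2 := ⟨_, rfl⟩
    have hK0 : 0 ≤ K := hK ▸ sq_nonneg _
    obtain ⟨M, hM⟩ : ∃ M, M = 2 * (K + 1) / ε := ⟨_, rfl⟩
    have hM0 : 0 < M := by rw [hM]; positivity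
    obtain ⟨F, hF⟩ : ∃ F : Finset Z3, ∀ x, x ∈ F ↔ h x < M :=
      ⟨(h₃.finite_lt M).toFinset, fun x => by simp⟩
    have hbound : ∀ n, ‖toL2 (u n) - toL2 v‖ ^ 2 ≤ ∑ x ∈ F, (u n x - v x) ^ 2 + K / M := by
      intro n
      have hsum : Summable fun x => h x * (u n - v) x ^ 2 := (u n - v).summable_weighted
      have hle : ∀ x, (u n - v) x ^ 2 ≤
          (F : Set Z3).indicator (fun x => (u n x - v x) ^ 2) x + M⁻¹ * (h x * (u n - v) x ^ 2) := by
        intro x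
        by_cases hx : x ∈ F
        · rw [indicator_of_mem (by simpa using hx)]
          refine le_add_of_nonneg_right (mul_nonneg (inv_nonneg.2 hM0.le) ?_)
          exact mul_nonneg (hh.nonneg x) (sq_nonneg _)
        · rw [indicator_of_notMem (by simpa using hx), zero_add, ← mul_assoc]
          refine le_mul_of_one_le_left (sq_nonneg _) ?_
          rw [inv_mul_eq_div, one_le_div hM0]
          exact not_lt.1 fun hlt => hx ((hF x).2 hlt)
      have hind : HasSum ((F : Set Z3).indicator (fun x => (u n x - v x) ^ 2))
          (∑ x ∈ F, (u n x - v x) ^ 2) :=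
        hasSum_subtype_iff_indicator.1 (F.hasSum fun x => (u n x - v x) ^ 2)
      rw [← map_sub, L2.norm_sq_eq]
      refine ((u n - v).summable_sq.tsum_le_tsum hle
        (hind.summable.add (hsum.mul_left _))).trans ?_
      rw [hind.summable.tsum_add (hsum.mul_left _), hind.tsum_eq, tsum_mul_left, inv_mul_eq_div]
      gcongr
      refine (u n - v).tsum_weighted_le.trans ?_
      rw [hK]
      exact pow_le_pow_left₀ (norm_nonneg _)
        ((norm_sub_le _ _).trans (add_le_add_left (hB n) _)) 2
    have hfin : Tendsto (fun n => ∑ x ∈ F, (u n x - v x) ^ 2) atTop (𝓝 0) := by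
      have h1 : Tendsto (fun n => ∑ x ∈ F, (u n x - v x) ^ 2) atTop
          (𝓝 (∑ x ∈ F, (v x - v x) ^ 2)) :=
        tendsto_finsetSum _ fun x _ => ((huv x).sub_const _).pow 2
      simpa using h1
    have hKM : K / M < ε / 2 := by
      rw [hM, div_lt_iff₀ (by positivity)]
      field_simp
      linarith
    obtain ⟨N, hN⟩ := eventually_atTop.1 (hfin.eventually_lt_const (half_pos hε))
    refine ⟨N, fun n hn => ?_⟩
    rw [dist_zero_right, norm_of_nonneg (sq_nonneg _)]
    linarith [hbound n, hN n hn]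
  have := (continuous_sqrt.tendsto 0).comp hsq
  simpa [Function.comp_def, sqrt_sq (norm_nonneg _)] using this

theorem exists_subseq_tendsto_toL2 (h₃ : Coercive h) {u : ℕ → HSpace ha hh} {B : ℝ}
    (hB : ∀ n, ‖u n‖ ≤ B) : ∃ v : HSpace ha hh, ∃ φ : ℕ → ℕ, StrictMono φ ∧
      Tendsto (fun n => toL2 (u (φ n))) atTop (𝓝 (toL2 v)) := by
  have hB0 : 0 ≤ B := (norm_nonneg _).trans (hB 0)
  obtain ⟨C, hC⟩ : ∃ C, ∀ n x, |u n x| ≤ C :=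
    ⟨‖(toL2 : HSpace ha hh →L[ℝ] L2)‖ * B, fun n x => ((toL2 (u n)).abs_apply_le x).trans
      ((toL2.le_opNorm (u n)).trans (mul_le_mul_of_nonneg_left (hB n) (norm_nonneg _)))⟩
  -- Tychonoff on the product of the intervals `[-C, C]` over the countable lattice replaces a
  -- diagonal argument.
  obtain ⟨g, -, φ, hφ, hg⟩ :=
    (isCompact_univ_pi fun _ : Z3 => isCompact_Icc (a := -C) (b := C)).tendsto_subseq
      (x := fun n => (u n : Z3 → ℝ)) fun n x _ => abs_le.1 (hC n x)
  rw [tendsto_pi_nhds] at hg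
  -- Fatou through finite partial sums: the limit inherits the weighted bound.
  have hsum : Summable fun x => h x * g x ^ 2 := by
    refine summable_of_sum_le (c := B ^ 2) (fun x => mul_nonneg (hh.nonneg x) (sq_nonneg _))
      fun F => ?_
    have h1 : Tendsto (fun n => ∑ x ∈ F, h x * u (φ n) x ^ 2) atTop
        (𝓝 (∑ x ∈ F, h x * g x ^ 2)) :=
      tendsto_finsetSum _ fun x _ => ((hg x).pow 2).const_mul _
    refine le_of_tendsto' h1 fun n => ?_
    refine ((u (φ n)).summable_weighted.sum_le_tsum F fun x _ =>
      mul_nonneg (hh.nonneg x) (sq_nonneg _)).trans ((u (φ n)).tsum_weighted_le.trans ?_)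
    exact pow_le_pow_left₀ (norm_nonneg _) (hB _) 2
  have hsq : Summable fun x => g x ^ 2 := by
    have hpos := lowerBound_pos hh
    refine Summable.of_nonneg_of_le (fun _ => sq_nonneg _) (fun x => ?_)
      (hsum.mul_left (lowerBound hh)⁻¹)
    rw [inv_mul_eq_div, le_div_iff₀' hpos]
    exact mul_le_mul_of_nonneg_right (lowerBound_le hh x) (sq_nonneg _)
  exact ⟨⟨g, memH1_iff.2 hsq, hsum⟩, φ, hφ,
    tendsto_toL2_of_pointwise h₃ (fun n => hB (φ n)) hg⟩

/-- Lower semicontinuity of the norm, in Fatou form: only finitely many values of the function enter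
each finite sum of densities. -/
theorem norm_sq_le_of_tendsto {w : ℕ → HSpace ha hh} {v : HSpace ha hh} {c : ℕ → ℝ} {c' : ℝ}
    (hw : Tendsto (fun n => toL2 (w n)) atTop (𝓝 (toL2 v))) (hc : Tendsto c atTop (𝓝 c'))
    (hle : ∀ n, ‖w n‖ ^ 2 ≤ c n) : ‖v‖ ^ 2 ≤ c' := by
  have hpt : ∀ x, Tendsto (fun n => w n x) atTop (𝓝 (v x)) := L2.tendsto_apply hw
  have hterm : ∀ (z : HSpace ha hh) x, 0 ≤ a * gradForm z z x + h x * z x ^ 2 := fun z x =>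
    add_nonneg (mul_nonneg ha.le (gradForm_self_nonneg _ _))
      (mul_nonneg (hh.nonneg x) (sq_nonneg _))
  rw [v.norm_sq_eq_tsum]
  refine v.summable_norm_sq.tsum_le_of_sum_le fun F => ?_
  have h1 : Tendsto (fun n => ∑ x ∈ F, (a * gradForm (w n) (w n) x + h x * w n x ^ 2)) atTop
      (𝓝 (∑ x ∈ F, (a * gradForm v v x + h x * v x ^ 2))) := by
    refine tendsto_finsetSum _ fun x _ => ?_
    refine Tendsto.add (Tendsto.const_mul a ?_) (((hpt x).pow 2).const_mul _)
    refine Tendsto.const_mul _ (tendsto_finsetSum _ fun y _ => ?_)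
    exact ((hpt y).sub (hpt x)).mul ((hpt y).sub (hpt x))
  refine le_of_tendsto_of_tendsto' h1 hc fun n => le_trans ?_ (hle n)
  rw [(w n).norm_sq_eq_tsum]
  exact (w n).summable_norm_sq.sum_le_tsum F fun x _ => hterm (w n) x

theorem norm_toL2_pos_sub_le (u v : HSpace ha hh) :
    ‖toL2 u.pos - toL2 v.pos‖ ≤ ‖toL2 u - toL2 v‖ :=
  L2.norm_le_of_abs_le fun x => abs_max_sub_max_le_abs (u x) (v x) 0

theorem norm_toL2_neg_sub_le (u v : HSpace ha hh) :
    ‖toL2 u.neg - toL2 v.neg‖ ≤ ‖toL2 u - toL2 v‖ :=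
  L2.norm_le_of_abs_le fun x => by
    refine (abs_min_sub_min_le_max (u x) 0 (v x) 0).trans ?_
    rw [sub_zero, abs_zero]
    exact max_le le_rfl (abs_nonneg _)

theorem tendsto_toL2_pos {u : ℕ → HSpace ha hh} {v : HSpace ha hh}
    (hu : Tendsto (fun n => toL2 (u n)) atTop (𝓝 (toL2 v))) :
    Tendsto (fun n => toL2 (u n).pos) atTop (𝓝 (toL2 v.pos)) := by
  rw [tendsto_iff_norm_sub_tendsto_zero] at hu ⊢
  exact squeeze_zero (fun _ => norm_nonneg _) (fun n => norm_toL2_pos_sub_le _ _) hu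

theorem tendsto_toL2_neg {u : ℕ → HSpace ha hh} {v : HSpace ha hh}
    (hu : Tendsto (fun n => toL2 (u n)) atTop (𝓝 (toL2 v))) :
    Tendsto (fun n => toL2 (u n).neg) atTop (𝓝 (toL2 v.neg)) := by
  rw [tendsto_iff_norm_sub_tendsto_zero] at hu ⊢
  exact squeeze_zero (fun _ => norm_nonneg _) (fun n => norm_toL2_neg_sub_le _ _) hu

theorem tendsto_toL2_comb {u : ℕ → HSpace ha hh} {v : HSpace ha hh}
    (hu : Tendsto (fun n => toL2 (u n)) atTop (𝓝 (toL2 v))) (s t : ℝ) :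
    Tendsto (fun n => toL2 (comb s t (u n))) atTop (𝓝 (toL2 (comb s t v))) := by
  simp only [comb, map_add, map_smul]
  exact ((tendsto_toL2_pos hu).const_smul s).add ((tendsto_toL2_neg hu).const_smul t)

/-! ### Minimization on the Nehari set -/

/-- The right side of the hypothesis is of order `‖v‖^p` in `ℓ²` and the left at least of order
`‖v‖²`; division by the latter bounds `v` away from zero. -/
theorem lowerBound_le_of_norm_sq_le (hα₀ : 0 < α) (hα₃ : α < 3) (hp : 3 < p)
    {v : HSpace ha hh} (hv : v ≠ 0) {f : L1}
    (hle : ‖v‖ ^ 2 ≤ greenForm hα₀ hα₃ f (absPow hp (toL2 v))) :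
    lowerBound hh ≤ ‖greenForm hα₀ hα₃‖ * ‖f‖ * ‖toL2 v‖ ^ (p - 2) := by
  have h0 : 0 < ‖toL2 v‖ := by
    refine norm_pos_iff.2 fun h0 => hv (HSpace.ext fun x => ?_)
    rw [← toL2_apply, h0]
    rfl
  have h1 : lowerBound hh * ‖toL2 v‖ ^ 2 ≤
      ‖greenForm hα₀ hα₃‖ * ‖f‖ * ‖toL2 v‖ ^ (p - 2) * ‖toL2 v‖ ^ 2 :=
    calc _ ≤ ‖v‖ ^ 2 := v.lowerBound_mul_norm_toL2_sq_le.trans v.tsum_weighted_le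
      _ ≤ ‖greenForm hα₀ hα₃ f (absPow hp (toL2 v))‖ := hle.trans (le_abs_self _)
      _ ≤ ‖greenForm hα₀ hα₃‖ * ‖f‖ * ‖absPow hp (toL2 v)‖ :=
          (greenForm hα₀ hα₃).le_opNorm₂ _ _
      _ ≤ ‖greenForm hα₀ hα₃‖ * ‖f‖ * (‖toL2 v‖ ^ (p - 2) * ‖toL2 v‖ ^ 2) :=
          mul_le_mul_of_nonneg_left (norm_absPow_le hp _) (by positivity)
      _ = _ := by ring
  exact le_of_mul_le_mul_right h1 (by positivity)

/-- The gradient cross term and the Kirchhoff term in `(J'(u), u⁺) = 0` are nonnegative and can be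
dropped. -/
theorem norm_pos_sq_le_greenForm (hb : 0 < b) (hα₀ : 0 < α) (hα₃ : α < 3) (hp : 3 < p)
    {u : HSpace ha hh} (hu : u ∈ signChangingNehari ha hh b α p) :
    ‖u.pos‖ ^ 2 ≤ greenForm hα₀ hα₃ (absPow hp (toL2 u)) (absPow hp (toL2 u.pos)) := by
  obtain ⟨-, -, h₁, -⟩ := (mem_signChangingNehari_iff hα₀ hα₃ hp).1 hu
  rw [energyDeriv_pos] at h₁
  rw [absPow_eq_add, map_add, _root_.add_apply, greenForm_comm hα₀ hα₃ (absPow hp (toL2 u.neg))]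
  have hC := dirichletForm_pos_neg_nonneg u
  have h1 := mul_nonneg ha.le hC
  have h2 := mul_nonneg (mul_nonneg hb.le (dirichletForm_self_nonneg (toL2 u)))
    (add_nonneg (dirichletForm_self_nonneg (toL2 u.pos)) hC)
  linarith

theorem norm_neg_sq_le_greenForm (hb : 0 < b) (hα₀ : 0 < α) (hα₃ : α < 3) (hp : 3 < p)
    {u : HSpace ha hh} (hu : u ∈ signChangingNehari ha hh b α p) :
    ‖u.neg‖ ^ 2 ≤ greenForm hα₀ hα₃ (absPow hp (toL2 u)) (absPow hp (toL2 u.neg)) := by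
  obtain ⟨-, -, -, h₂⟩ := (mem_signChangingNehari_iff hα₀ hα₃ hp).1 hu
  rw [energyDeriv_neg] at h₂
  rw [absPow_eq_add, map_add, _root_.add_apply]
  have hC := dirichletForm_pos_neg_nonneg u
  have h1 := mul_nonneg ha.le hC
  have h2 := mul_nonneg (mul_nonneg hb.le (dirichletForm_self_nonneg (toL2 u)))
    (add_nonneg (dirichletForm_self_nonneg (toL2 u.neg)) hC)
  linarith

/-- If the limit were zero, the upper bound of `lowerBound_le_of_norm_sq_le` would tend to zero,
while `lowerBound hh` is a fixed positive number. -/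
theorem ne_zero_of_tendsto (hα₀ : 0 < α) (hα₃ : α < 3) (hp : 3 < p)
    {u v : ℕ → HSpace ha hh} {u' v' : HSpace ha hh}
    (hu : Tendsto (fun n => toL2 (u n)) atTop (𝓝 (toL2 u')))
    (hv : Tendsto (fun n => toL2 (v n)) atTop (𝓝 (toL2 v'))) (hv0 : ∀ n, v n ≠ 0)
    (hle : ∀ n, ‖v n‖ ^ 2 ≤
      greenForm hα₀ hα₃ (absPow hp (toL2 (u n))) (absPow hp (toL2 (v n)))) : v' ≠ 0 := by
  rintro rfl
  have h1 : Tendsto (fun n => ‖greenForm hα₀ hα₃‖ * ‖absPow hp (toL2 (u n))‖ *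
      ‖toL2 (v n)‖ ^ (p - 2)) atTop (𝓝 (‖greenForm hα₀ hα₃‖ * ‖absPow hp (toL2 u')‖ *
        ‖toL2 (0 : HSpace ha hh)‖ ^ (p - 2))) := by
    have h2 := ((hasStrictFDerivAt_absPow hp (toL2 u')).continuousAt.tendsto.comp hu).norm
    exact (h2.const_mul _).mul (hv.norm.rpow_const (Or.inr (by linarith)))
  rw [map_zero, norm_zero, zero_rpow (by linarith), mul_zero] at h1
  exact (lowerBound_pos hh).not_ge (ge_of_tendsto' h1 fun n =>
    lowerBound_le_of_norm_sq_le hα₀ hα₃ hp (hv0 n) (hle n))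

theorem signChangingNehari_nonempty (hb : 0 < b) (hα₀ : 0 < α) (hα₃ : α < 3) (hp : 3 < p) :
    (signChangingNehari ha hh b α p).Nonempty := by
  obtain ⟨u, hu⟩ : ∃ u : HSpace ha hh, u = pointMass ha hh 0 - pointMass ha hh 1 := ⟨_, rfl⟩
  have h0 : u 0 = 1 := by
    rw [hu, HSpace.sub_apply, pointMass_apply, pointMass_apply, if_pos rfl,
      if_neg zero_ne_one, sub_zero]
  have h1 : u 1 = -1 := by
    rw [hu, HSpace.sub_apply, pointMass_apply, pointMass_apply, if_pos rfl,
      if_neg one_ne_zero, zero_sub]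
  have hpos : u.pos ≠ 0 := fun h => by
    have : u.pos 0 = 0 := by rw [h]; rfl
    rw [HSpace.pos_apply, h0] at this
    norm_num at this
  have hneg : u.neg ≠ 0 := fun h => by
    have : u.neg 1 = 0 := by rw [h]; rfl
    rw [HSpace.neg_apply, h1] at this
    norm_num at this
  obtain ⟨s, t, -, -, hst⟩ := exists_comb_mem_signChangingNehari hb hα₀ hα₃ hp hpos hneg
  exact ⟨_, hst⟩

theorem exists_minimizer (hb : 0 < b) (hα₀ : 0 < α) (hα₃ : α < 3) (hp : 4 < p)
    (h₃ : Coercive h) : ∃ w ∈ signChangingNehari ha hh b α p,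
      ∀ v ∈ signChangingNehari ha hh b α p, energy b α p w ≤ energy b α p v := by
  have hp3 : 3 < p := by linarith
  have hbdd : BddBelow (energy b α p '' signChangingNehari ha hh b α p) := by
    refine ⟨0, ?_⟩
    rintro _ ⟨u, hu, rfl⟩
    exact le_trans (by positivity) (norm_sq_le_energy hb hα₀ hα₃ hp hu)
  obtain ⟨c, hanti, hc, hmem⟩ := exists_seq_tendsto_sInf
    ((signChangingNehari_nonempty (ha := ha) (hh := hh) hb hα₀ hα₃ hp3).image (energy b α p)) hbdd
  choose u hu huc using hmem
  -- The energies `c n` decrease, so `c 0` bounds them all.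
  have hB : ∀ n, ‖u n‖ ≤ √(4 * c 0) := fun n => by
    refine le_sqrt_of_sq_le ?_
    have h1 := norm_sq_le_energy hb hα₀ hα₃ hp (hu n)
    rw [huc] at h1
    linarith [hanti (Nat.zero_le n)]
  obtain ⟨v, φ, hφ, hv⟩ := exists_subseq_tendsto_toL2 h₃ hB
  have hpos : v.pos ≠ 0 := ne_zero_of_tendsto hα₀ hα₃ hp3 hv (tendsto_toL2_pos hv)
    (fun n => (hu (φ n)).1) fun n => norm_pos_sq_le_greenForm hb hα₀ hα₃ hp3 (hu (φ n))
  have hneg : v.neg ≠ 0 := ne_zero_of_tendsto hα₀ hα₃ hp3 hv (tendsto_toL2_neg hv)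
    (fun n => (hu (φ n)).2.1) fun n => norm_neg_sq_le_greenForm hb hα₀ hα₃ hp3 (hu (φ n))
  obtain ⟨s, t, hs, ht, hst⟩ := exists_comb_mem_signChangingNehari hb hα₀ hα₃ hp3 hpos hneg
  refine ⟨_, hst, fun z hz => le_trans ?_ (csInf_le hbdd (mem_image_of_mem _ hz))⟩
  have hw := tendsto_toL2_comb hv s t
  have hR := ((continuous_lowerTerm b hα₀ hα₃ hp3).tendsto _).comp hw
  -- The projection factors `s, t` of the limit are applied to the whole sequence. Fibre maximality
  -- bounds the energy of `comb s t (u (φ n))` by `c (φ n)`, which is then solved for the squared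
  -- norm.
  have key := norm_sq_le_of_tendsto hw (((hc.comp hφ.tendsto_atTop).sub hR).const_mul 2)
    fun n => by
      have h1 := energy_comb_le hb hα₀ hα₃ hp (hu (φ n)) hs.le ht.le
      rw [huc, energy_eq hα₀ hα₃ hp3] at h1
      simp only [Function.comp_apply]
      linarith
  rw [energy_eq hα₀ hα₃ hp3]
  linarith

end Compactness

section Criticality

variable {a b α p : ℝ} {h : Z3 → ℝ} {ha : 0 < a} {hh : UniformlyPositive h}

/-! ### Minimizers on the Nehari set are critical points -/

/-- The Dirichlet form is bounded on `ℓ²`, so the norm of `H` is equivalent to `(∫ h u²)^{1/2}`,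
which is monotone in `|u|`. Applied to differences, this makes both truncations Lipschitz on `H`. -/
theorem HSpace.exists_norm_le_of_abs_le (ha : 0 < a) (hh : UniformlyPositive h) :
    ∃ C, 0 ≤ C ∧ ∀ v w : HSpace ha hh, (∀ x, |v x| ≤ |w x|) → ‖v‖ ≤ C * ‖w‖ := by
  have hpos := lowerBound_pos hh
  obtain ⟨K, hK⟩ : ∃ K, K = a * (‖dirichletForm‖ / lowerBound hh) + 1 := ⟨_, rfl⟩
  have hK0 : 0 ≤ K := by rw [hK]; positivity
  refine ⟨√K, sqrt_nonneg _, fun v w hvw => ?_⟩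
  refine abs_le_of_sq_le_sq' ?_ (by positivity) |>.2
  rw [mul_pow, sq_sqrt hK0]
  have h1 : dirichletForm (toL2 v) (toL2 v) ≤
      ‖dirichletForm‖ / lowerBound hh * ∑' x, h x * v x ^ 2 := by
    calc _ ≤ ‖dirichletForm‖ * ‖toL2 v‖ * ‖toL2 v‖ :=
          (le_abs_self _).trans (dirichletForm.le_opNorm₂ _ _)
      _ = ‖dirichletForm‖ / lowerBound hh * (lowerBound hh * ‖toL2 v‖ ^ 2) := by
          field_simp
      _ ≤ _ := mul_le_mul_of_nonneg_left v.lowerBound_mul_norm_toL2_sq_le (by positivity)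
  calc ‖v‖ ^ 2 ≤ K * ∑' x, h x * v x ^ 2 := by
        rw [v.norm_sq_eq, hK, add_mul, one_mul, mul_assoc]
        exact add_le_add_left (mul_le_mul_of_nonneg_left h1 ha.le) _
    _ ≤ K * ‖w‖ ^ 2 := by
        refine mul_le_mul_of_nonneg_left (le_trans ?_ w.tsum_weighted_le) hK0
        exact v.summable_weighted.tsum_le_tsum
          (fun x => mul_le_mul_of_nonneg_left (sq_le_sq.2 (hvw x)) (hh.nonneg x))
          w.summable_weighted

theorem HSpace.exists_norm_parts_sub_le (ha : 0 < a) (hh : UniformlyPositive h) :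
    ∃ C, 0 ≤ C ∧ ∀ v w : HSpace ha hh,
      ‖v.pos - w.pos‖ ≤ C * ‖v - w‖ ∧ ‖v.neg - w.neg‖ ≤ C * ‖v - w‖ := by
  obtain ⟨C, hC, hle⟩ := HSpace.exists_norm_le_of_abs_le ha hh
  refine ⟨C, hC, fun v w => ⟨hle _ _ fun x => ?_, hle _ _ fun x => ?_⟩⟩
  · exact abs_max_sub_max_le_abs (v x) (w x) 0
  · refine (abs_min_sub_min_le_max (v x) 0 (w x) 0).trans ?_
    rw [sub_zero, abs_zero]
    exact max_le le_rfl (abs_nonneg _)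

theorem HSpace.continuous_pos : Continuous (HSpace.pos : HSpace ha hh → HSpace ha hh) := by
  obtain ⟨C, hC, hle⟩ := HSpace.exists_norm_parts_sub_le ha hh
  exact (LipschitzWith.of_dist_le' fun v w => by
    simpa only [dist_eq_norm] using (hle v w).1).continuous

theorem HSpace.continuous_neg : Continuous (HSpace.neg : HSpace ha hh → HSpace ha hh) := by
  obtain ⟨C, hC, hle⟩ := HSpace.exists_norm_parts_sub_le ha hh
  exact (LipschitzWith.of_dist_le' fun v w => by
    simpa only [dist_eq_norm] using (hle v w).2).continuous

theorem norm_comb_sub_comb_sub_le {C δ : ℝ} {v w : HSpace ha hh}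
    (hC : ‖v.pos - w.pos‖ ≤ C * ‖v - w‖ ∧ ‖v.neg - w.neg‖ ≤ C * ‖v - w‖) (hδ : 0 ≤ δ)
    {s t : ℝ} (hs : |s - 1| ≤ δ) (ht : |t - 1| ≤ δ) :
    ‖comb s t v - comb s t w - (v - w)‖ ≤ 2 * δ * C * ‖v - w‖ := by
  have h1 : comb s t v - comb s t w - (v - w) =
      (s - 1) • (v.pos - w.pos) + (t - 1) • (v.neg - w.neg) := by
    nth_rewrite 2 [← v.pos_add_neg, ← w.pos_add_neg]
    unfold comb
    module
  rw [h1]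
  refine (norm_add_le _ _).trans ?_
  rw [norm_smul, norm_smul, norm_eq_abs, norm_eq_abs]
  have e1 := mul_le_mul hs hC.1 (norm_nonneg _) hδ
  have e2 := mul_le_mul ht hC.2 (norm_nonneg _) hδ
  linarith

/-- A descent direction `φ` would give a competitor in `ℳ`: the maximum point `q` of the fibre of `w
+ ε φ`. Its energy is compared with that of `comb q.1 q.2 w`, itself at most `J(w)`, so `q` need not
depend differentiably on `ε`. -/
theorem energyDeriv_nonneg_of_minimizer (hb : 0 < b) (hα₀ : 0 < α) (hα₃ : α < 3) (hp : 4 < p)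
    (hp3 : 3 < p) {w : HSpace ha hh} (hw : w ∈ signChangingNehari ha hh b α p)
    (hmin : ∀ v ∈ signChangingNehari ha hh b α p, energy b α p w ≤ energy b α p v)
    (φ : HSpace ha hh) : 0 ≤ energyDeriv b hα₀ hα₃ hp3 w φ := by
  by_contra! hneg
  obtain ⟨C, hC0, hC⟩ := HSpace.exists_norm_parts_sub_le ha hh
  obtain ⟨Λ, hΛ⟩ : ∃ Λ, Λ = energyDeriv b hα₀ hα₃ hp3 w := ⟨_, rfl⟩
  rw [← hΛ] at hneg
  have hstrict : HasStrictFDerivAt (energy b α p) Λ w :=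
    hΛ ▸ hasStrictFDerivAt_energy hα₀ hα₃ hp3 w
  -- One `δ` bounds both the distance of `q` from `(1, 1)` and the relative error of the
  -- linearization; the displayed inequality is the final contradiction divided by `ε`. The bound `1
  -- / 2` puts that ball inside the square `K`.
  obtain ⟨δ, hδ, hδ2, hδsmall⟩ : ∃ δ : ℝ, 0 < δ ∧ δ < 1 / 2 ∧
      ‖Λ‖ * (2 * δ * C * ‖φ‖) + δ * (‖φ‖ + 2 * δ * C * ‖φ‖) < -Λ φ := by
    have hc : Continuous fun δ : ℝ =>
      ‖Λ‖ * (2 * δ * C * ‖φ‖) + δ * (‖φ‖ + 2 * δ * C * ‖φ‖) := by fun_prop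
    have h1 : ∀ᶠ δ in 𝓝 (0 : ℝ),
        ‖Λ‖ * (2 * δ * C * ‖φ‖) + δ * (‖φ‖ + 2 * δ * C * ‖φ‖) < -Λ φ :=
      (isOpen_lt hc continuous_const).mem_nhds (by simpa using hneg)
    have h2 : ∀ᶠ δ in 𝓝 (0 : ℝ), δ < 1 / 2 := Iio_mem_nhds (by norm_num)
    obtain ⟨δ, ⟨h3, h4⟩, h5⟩ := (((h2.and h1).filter_mono
      (nhdsWithin_le_nhds (s := Ioi 0))).and eventually_mem_nhdsWithin).exists
    exact ⟨δ, h5, h3, h4⟩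
  have hpath : Continuous fun ε : ℝ => w + ε • φ := by fun_prop
  have hΦ : Continuous fun z : ℝ × (ℝ × ℝ) => comb z.2.1 z.2.2 (w + z.1 • φ) := by
    have h1 := HSpace.continuous_pos.comp (hpath.comp (continuous_fst (X := ℝ) (Y := ℝ × ℝ)))
    have h2 := HSpace.continuous_neg.comp (hpath.comp (continuous_fst (X := ℝ) (Y := ℝ × ℝ)))
    exact ((continuous_fst.comp continuous_snd).smul h1).add
      ((continuous_snd.comp continuous_snd).smul h2)
  have hΦ₀ : Continuous fun z : ℝ × (ℝ × ℝ) => comb z.2.1 z.2.2 w :=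
    (continuous_comb w).comp continuous_snd
  have hf : Continuous fun z : ℝ × (ℝ × ℝ) => energy b α p (comb z.2.1 z.2.2 (w + z.1 • φ)) :=
    (continuous_energy hα₀ hα₃ hp3).comp hΦ
  have hf₁ : Continuous fun z : ℝ × (ℝ × ℝ) => energy b α p (w + z.1 • φ) :=
    (continuous_energy hα₀ hα₃ hp3).comp (hpath.comp continuous_fst)
  have hest : ∀ᶠ z : ℝ × (ℝ × ℝ) in 𝓝 (0, (1, 1)),
      ‖energy b α p (comb z.2.1 z.2.2 (w + z.1 • φ)) - energy b α p (comb z.2.1 z.2.2 w) -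
        Λ (comb z.2.1 z.2.2 (w + z.1 • φ) - comb z.2.1 z.2.2 w)‖ ≤
      δ * ‖comb z.2.1 z.2.2 (w + z.1 • φ) - comb z.2.1 z.2.2 w‖ := by
    have h1 := (hstrict.isLittleO.bound hδ)
    have h2 : Tendsto (fun z : ℝ × (ℝ × ℝ) =>
        (comb z.2.1 z.2.2 (w + z.1 • φ), comb z.2.1 z.2.2 w)) (𝓝 (0, (1, 1))) (𝓝 (w, w)) := by
      convert! (hΦ.prodMk hΦ₀).tendsto (0, (1, 1)) using 2
      simp [comb_one_one]
    exact h2.eventually h1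
  -- The neighbourhood of `(1, 1)` has to be fixed before `ε`, since the next smallness condition on
  -- `ε` refers to its complement.
  rw [nhds_prod_eq, eventually_prod_iff] at hest
  obtain ⟨pV, hV, pU, hU, hVU⟩ := hest
  obtain ⟨U, hUsub, hUo, hU1⟩ := mem_nhds_iff.1 (inter_mem hU (Metric.ball_mem_nhds (1, 1) hδ))
  obtain ⟨K, hK⟩ : ∃ K : Set (ℝ × ℝ), K = Icc (1 / 2) (3 / 2) ×ˢ Icc (1 / 2) (3 / 2) :=
    ⟨_, rfl⟩
  have hKc : IsCompact K := hK ▸ isCompact_Icc.prod isCompact_Icc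
  have hK1 : ((1, 1) : ℝ × ℝ) ∈ K := by
    rw [hK]
    refine mem_prod.2 ⟨?_, ?_⟩ <;> norm_num
  -- At `ε = 0` the value at `(1, 1)` strictly exceeds all values on the compact set `K \ U`;
  -- compactness carries this to small `ε` and forces the maximum point into `U`.
  have htube : ∀ᶠ ε in 𝓝 (0 : ℝ), ∀ q ∈ K \ U,
      energy b α p (comb q.1 q.2 (w + ε • φ)) < energy b α p (w + ε • φ) := by
    refine (hKc.diff hUo).eventually_forall_of_forall_eventually fun q hq => ?_
    refine (isOpen_lt hf hf₁).mem_nhds ?_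
    rw [mem_ofPred_eq, zero_smul, add_zero]
    have hqK := hq.1
    rw [hK] at hqK
    refine energy_comb_lt hb hα₀ hα₃ hp hw (by linarith [hqK.1.1]) (by linarith [hqK.2.1]) ?_
    rintro h1
    exact hq.2 (by rwa [← h1] at hU1)
  have hpos : ∀ᶠ ε in 𝓝 (0 : ℝ), (w + ε • φ).pos ≠ 0 :=
    (isOpen_ne_fun (HSpace.continuous_pos.comp hpath) continuous_const).mem_nhds
      (by simpa using hw.1)
  have hneg' : ∀ᶠ ε in 𝓝 (0 : ℝ), (w + ε • φ).neg ≠ 0 :=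
    (isOpen_ne_fun (HSpace.continuous_neg.comp hpath) continuous_const).mem_nhds
      (by simpa using hw.2.1)
  obtain ⟨ε, ⟨hεV, hεt, hεp, hεn⟩, hε⟩ := (((hV.and (htube.and (hpos.and hneg'))).filter_mono
    (nhdsWithin_le_nhds (s := Ioi 0))).and eventually_mem_nhdsWithin).exists
  have hε0 : 0 < ε := hε
  obtain ⟨q, hqK, hqmax⟩ := hKc.exists_isMaxOn ⟨_, hK1⟩
    (((continuous_energy (b := b) hα₀ hα₃ hp3).comp (continuous_comb (w + ε • φ))).continuousOn)
  have hqU : q ∈ U := by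
    by_contra hqU
    have h1 := isMaxOn_iff.1 hqmax (1, 1) hK1
    simp only [Function.comp_apply, comb_one_one] at h1
    exact (hεt q ⟨hqK, hqU⟩).not_ge h1
  obtain ⟨hq1, hq2⟩ := hUsub hqU
  rw [Metric.mem_ball, Prod.dist_eq, max_lt_iff, dist_eq, dist_eq] at hq2
  obtain ⟨hqs, hqt⟩ := hq2
  dsimp only at hqs hqt
  have hs := abs_lt.1 hqs
  have ht := abs_lt.1 hqt
  have hxM : comb q.1 q.2 (w + ε • φ) ∈ signChangingNehari ha hh b α p := by
    refine comb_mem_signChangingNehari hα₀ hα₃ hp3 hεp hεn (by linarith) (by linarith)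
      (hqmax.isLocalMax ?_)
    rw [hK, ← Prod.mk.eta (p := q)]
    exact prod_mem_nhds (Icc_mem_nhds (by linarith) (by linarith))
      (Icc_mem_nhds (by linarith) (by linarith))
  have hx := hmin _ hxM
  have hy := energy_comb_le hb hα₀ hα₃ hp hw (s := q.1) (t := q.2) (by linarith) (by linarith)
  have hd := hVU hεV hq1
  dsimp only at hd
  have hz := norm_comb_sub_comb_sub_le (hC (w + ε • φ) w) hδ.le hqs.le hqt.le
  rw [add_sub_cancel_left, norm_smul, norm_of_nonneg hε0.le] at hz
  obtain ⟨D, hD⟩ : ∃ D, D = comb q.1 q.2 (w + ε • φ) - comb q.1 q.2 w := ⟨_, rfl⟩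
  rw [← hD] at hd hz
  -- `D` differs from `ε φ` by at most `2 δ C ε ‖φ‖`, because the coefficients of the combination
  -- are within `δ` of 1.
  have hΛD : Λ D ≤ ε * Λ φ + ‖Λ‖ * (2 * δ * C * (ε * ‖φ‖)) := by
    have h1 : Λ D = ε * Λ φ + Λ (D - ε • φ) := by
      rw [map_sub, map_smul, smul_eq_mul]
      ring
    rw [h1]
    exact add_le_add_right ((le_abs_self _).trans ((Λ.le_opNorm _).trans
      (mul_le_mul_of_nonneg_left hz (norm_nonneg _)))) _
  have hDn : ‖D‖ ≤ ε * ‖φ‖ + 2 * δ * C * (ε * ‖φ‖) := by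
    calc ‖D‖ = ‖ε • φ + (D - ε • φ)‖ := by rw [add_sub_cancel]
      _ ≤ ‖ε • φ‖ + ‖D - ε • φ‖ := norm_add_le _ _
      _ ≤ _ := by
        rw [norm_smul, norm_of_nonneg hε0.le]
        exact add_le_add_right hz _
  have h1 := (le_abs_self _).trans hd
  have h2 := mul_le_mul_of_nonneg_left hDn hδ.le
  have h3 := mul_lt_mul_of_pos_left hδsmall hε0
  linarith

theorem fderiv_eq_zero_of_minimizer (hb : 0 < b) (hα₀ : 0 < α) (hα₃ : α < 3) (hp : 4 < p)
    {w : HSpace ha hh} (hw : w ∈ signChangingNehari ha hh b α p)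
    (hmin : ∀ v ∈ signChangingNehari ha hh b α p, energy b α p w ≤ energy b α p v) :
    fderiv ℝ (energy b α p) w = 0 := by
  have hp3 : 3 < p := by linarith
  rw [fderiv_energy hα₀ hα₃ hp3]
  ext φ
  refine le_antisymm ?_ (energyDeriv_nonneg_of_minimizer hb hα₀ hα₃ hp hp3 hw hmin φ)
  have h1 := energyDeriv_nonneg_of_minimizer hb hα₀ hα₃ hp hp3 hw hmin (-φ)
  rw [map_neg] at h1
  exact neg_nonneg.1 h1

end Criticality

end KirchhoffChoquard

end

/-! ### Existence of the ground state sign-changing solution. -/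

theorem theorem1p2 (a b α p : ℝ) (ha : 0 < a) (hb : 0 < b) (hα₀ : 0 < α) (hα₃ : α < 3)
    (hp : 4 < p) (h : Z3 → ℝ) (h₁ : UniformlyPositive h) (h₃ : Coercive h) :
    Differentiable ℝ (energy b α p : HSpace ha h₁ → ℝ) ∧
    ∃ u : HSpace ha h₁,
      u.pos ≠ 0 ∧ u.neg ≠ 0 ∧
      u ∈ signChangingNehari ha h₁ b α p ∧
      fderiv ℝ (energy b α p) u = 0 ∧
      SolvesEquation a b α p h u ∧
      IsGLB (energy b α p '' signChangingNehari ha h₁ b α p) (energy b α p u) := by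
  have hp3 : 3 < p := by linarith
  obtain ⟨u, hu, hmin⟩ := exists_minimizer (ha := ha) (hh := h₁) hb hα₀ hα₃ hp h₃
  have hcrit := fderiv_eq_zero_of_minimizer hb hα₀ hα₃ hp hu hmin
  refine ⟨differentiable_energy hα₀ hα₃ hp3, u, hu.1, hu.2.1, hu, hcrit,
    solvesEquation_of_fderiv_eq_zero hα₀ hα₃ hp3 hcrit, ?_, fun c hc => hc ⟨u, hu, rfl⟩⟩
  rintro _ ⟨v, hv, rfl⟩
  exact hmin v hv
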